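/- A graph is $t$-claw-free if it has no induced subgraph isomorphic to the $t$-claw $K_{1,t}$. In the $k$-Dominating Set problem on $t$-claw-free graphs, an instance is a finite undirected simple $t$-claw-free graph $G$ together with an integer $k\ge 0$, the parameter is $k$, and the question is whether $G$ has a dominating set with at most $k$ vertices, that is, a set $D$ of at most $k$ vertices such that every vertex outside $D$ has a neighbour in $D$. An fpt-reduction from a parameterized problem $P$ to a parameterized problem $Q$ is a map from the instances of $P$ to the instances of $Q$ that preserves the answer, that can be computed in time at most $f(k)\cdot (n+1)^{c}$ on instances of size $n$ and parameter $k$, and that maps instances with parameter $k$ to instances with parameter at most $g(k)$, where $f,g:\mathbb{N}\to\mathbb{N}$ are computable functions and $c$ is a constant. For a Boolean circuit with one output, the depth is the maximum number of gates, and the weft the maximum number of large gates (gates of fan-in greater than $2$), on a path from an input to the output. The class $\mathrm{W}[2]$ consists of the parameterized problems $P$ for which there is a constant $d$ such that $P$ has an fpt-reduction to the following problem: given a Boolean circuit of weft at most $2$ and depth at most $d$ and an integer $k\ge 0$ (the parameter), is there a satisfying assignment that sets exactly $k$ inputs to true? A parameterized problem $Q$ is $\mathrm{W}[2]$-hard if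 every problem in $\mathrm{W}[2]$ has an fpt-reduction to $Q$. **Theorem.** For every integer $t\ge 4$, the $k$-Dominating Set problem on $t$-claw-free graphs is $\mathrm{W}[2]$-hard. -/

import Mathlib

/-!
Machine model, parameterized problems, fpt-reductions, the W-hierarchy (through circuits of bounded
weft and depth), and Dominating Set restricted to `t`-claw-free graphs.
-/

namespace ParamComplexity

/-! ### Random access machine

A program uses finitely many arrays of natural numbers, all cells of which are initially `0`
except for the input. The arithmetic is addition and truncated subtraction only (no
multiplication), so that the unit-cost running time is polynomially related to that of a
Turing machine. -/

/-- Memory: `s a i` is the content of cell `i` of array `a`. -/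
abbrev Store := ℕ → ℕ → ℕ

inductive Expr where
  | const (n : ℕ)
  | read (a : ℕ) (i : Expr)
  | add (e₁ e₂ : Expr)
  | sub (e₁ e₂ : Expr)

def Expr.eval (s : Store) : Expr → ℕ
  | const n => n
  | read a i => s a (i.eval s)
  | add e₁ e₂ => e₁.eval s + e₂.eval s
  | sub e₁ e₂ => e₁.eval s - e₂.eval s

def Store.set (s : Store) (a i v : ℕ) : Store :=
  fun b j => if b = a ∧ j = i then v else s b j

/-- Programs: `write a i e` is the assignment `a[i] := e`; a test succeeds if its value is not
zero. -/
inductive Prog where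
  | skip
  | write (a : ℕ) (i e : Expr)
  | seq (p q : Prog)
  | ite (e : Expr) (p q : Prog)
  | loop (e : Expr) (p : Prog)

/-- `Run p s s' T`: started in the store `s`, the program `p` halts in the store `s'` after exactly
`T` steps. Every executed assignment and every executed test is one step. -/
inductive Run : Prog → Store → Store → ℕ → Prop
  | skip (s : Store) : Run .skip s s 0
  | write (s : Store) (a : ℕ) (i e : Expr) :
      Run (.write a i e) s (s.set a (i.eval s) (e.eval s)) 1
  | seq {p q : Prog} {s s' s'' : Store} {T T' : ℕ} :
      Run p s s' T → Run q s' s'' T' → Run (.seq p q) s s'' (T + T')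
  | ite_true {e : Expr} {p q : Prog} {s s' : Store} {T : ℕ} :
      e.eval s ≠ 0 → Run p s s' T → Run (.ite e p q) s s' (T + 1)
  | ite_false {e : Expr} {p q : Prog} {s s' : Store} {T : ℕ} :
      e.eval s = 0 → Run q s s' T → Run (.ite e p q) s s' (T + 1)
  | loop_true {e : Expr} {p : Prog} {s s' s'' : Store} {T T' : ℕ} :
      e.eval s ≠ 0 → Run p s s' T → Run (.loop e p) s' s'' T' →
        Run (.loop e p) s s'' (T + T' + 1)
  | loop_false {e : Expr} {p : Prog} {s : Store} :
      e.eval s = 0 → Run (.loop e p) s s 1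

/-- A bit string written in an array: `1` stands for the bit `false`, `2` for `true`, and `0` is
the blank that follows the string. -/
def tape (x : List Bool) (i : ℕ) : ℕ :=
  match x[i]? with
  | none => 0
  | some false => 1
  | some true => 2

/-- The initial store: the string `x` in array `0`, the parameter `k` in cell `0` of array `1`. -/
def initStore (x : List Bool) (k : ℕ) : Store := fun a i =>
  if a = 0 then tape x i else if a = 1 ∧ i = 0 then k else 0

/-- The output, read in the same format (array `0` up to the first blank, and cell `0` of
array `1`), is `(y, l)`. -/
def HasOutput (s : Store) (y : List Bool) (l : ℕ) : Prop :=
  (∀ i ≤ y.length, s 0 i = tape y i) ∧ s 1 0 = l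

/-! ### Parameterized problems and fpt-reductions -/

/-- A parameterized decision problem: instances, given to machines as a bit string together with
the parameter, and the set of yes-instances. -/
structure ParamProblem where
  Inst : Type
  encode : Inst → List Bool
  param : Inst → ℕ
  encode_injective : Function.Injective fun I => (encode I, param I)
  Yes : Inst → Prop

/-- Many-one fpt-reductions: computable in time `f(k) * n ^ c` with `f` computable, preserving the
answer, and with the new parameter bounded by a computable function `g` of the old one. -/
def FPTReducible (P Q : ParamProblem) : Prop :=
  ∃ (F : P.Inst → Q.Inst) (p : Prog) (f g : ℕ → ℕ) (c : ℕ),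
    Computable f ∧ Computable g ∧
    (∀ I, P.Yes I ↔ Q.Yes (F I)) ∧
    (∀ I, Q.param (F I) ≤ g (P.param I)) ∧
    ∀ I, ∃ (s : Store) (T : ℕ),
      Run p (initStore (P.encode I) (P.param I)) s T ∧
      HasOutput s (Q.encode (F I)) (Q.param (F I)) ∧
      T ≤ f (P.param I) * ((P.encode I).length + 1) ^ c

/-! ### Boolean circuits -/

inductive NodeKind where
  | input
  | not
  | and
  | or
  deriving DecidableEq

/-- A Boolean circuit with one output: a directed acyclic graph whose nodes are listed in a
topological order. `wire j i` says that the value of `j` is fed into `i`. -/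
structure Circuit where
  size : ℕ
  kind : Fin size → NodeKind
  wire : Fin size → Fin size → Bool
  out : Fin size
  wire_lt : ∀ j i, wire j i = true → j < i
  input_source : ∀ i, kind i = .input → ∀ j, wire j i = false
  gate_fed : ∀ i, kind i ≠ .input → ∃ j, wire j i = true
  not_unary : ∀ i, kind i = .not → ∃! j, wire j i = true

namespace Circuit

/-- The value of node `i` when exactly the input nodes in `S` are set to true. -/
def Val (C : Circuit) (S : Finset (Fin C.size)) (i : Fin C.size) : Prop :=
  match C.kind i with
  | .input => i ∈ S
  | .not => ∀ j, (h : C.wire j i = true) → ¬ C.Val S j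
  | .and => ∀ j, (h : C.wire j i = true) → C.Val S j
  | .or => ∃ j, ∃ (h : C.wire j i = true), C.Val S j
termination_by i
decreasing_by all_goals exact C.wire_lt _ _ h

def fanIn (C : Circuit) (i : Fin C.size) : ℕ :=
  (Finset.univ.filter fun j => C.wire j i = true).card

/-- Directed paths from an input node to the output node. -/
def IsInputOutputPath (C : Circuit) (l : List (Fin C.size)) : Prop :=
  l.IsChain (fun j i => C.wire j i = true) ∧
  (∃ i, l.head? = some i ∧ C.kind i = .input) ∧
  l.getLast? = some C.out

/-- At most `d` gates on every input-output path. -/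
def DepthLE (C : Circuit) (d : ℕ) : Prop :=
  ∀ l, C.IsInputOutputPath l → l.countP (fun i => decide (C.kind i ≠ .input)) ≤ d

/-- At most `t` large gates (gates of fan-in greater than two) on every input-output path. -/
def WeftLE (C : Circuit) (t : ℕ) : Prop :=
  ∀ l, C.IsInputOutputPath l → l.countP (fun i => decide (2 < C.fanIn i)) ≤ t

/-- Some assignment that sets exactly `k` input nodes to true makes the output true. -/
def WeightedSat (C : Circuit) (k : ℕ) : Prop :=
  ∃ S : Finset (Fin C.size), (∀ i ∈ S, C.kind i = .input) ∧ S.card = k ∧ C.Val S C.out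

end Circuit

/-- The number `n` in unary, closed by `false`. -/
def unary (n : ℕ) : List Bool := List.replicate n true ++ [false]

/-- An `n × n` Boolean matrix, row by row. -/
def matrixBits {n : ℕ} (M : Fin n → Fin n → Bool) : List Bool :=
  List.ofFn fun p : Fin (n * n) => M p.divNat p.modNat

def NodeKind.bits : NodeKind → Bool × Bool
  | .input => (false, false)
  | .not => (false, true)
  | .and => (true, false)
  | .or => (true, true)

/-- Number of nodes in unary, two lists with the two bits of the kind of every node, the output
node (one-hot), and the matrix of the wires. -/
def Circuit.encode (C : Circuit) : List Bool :=
  unary C.size ++ List.ofFn (fun i => (C.kind i).bits.1) ++ List.ofFn (fun i => (C.kind i).bits.2)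
    ++ List.ofFn (fun i => decide (i = C.out)) ++ matrixBits C.wire

theorem unary_append_inj {m n : ℕ} {x y : List Bool} (h : unary m ++ x = unary n ++ y) :
    m = n ∧ x = y := by
  induction m generalizing n with
  | zero => cases n <;> simp_all [unary, List.replicate_succ]
  | succ m ih =>
    cases n with
    | zero => simp [unary, List.replicate_succ] at h
    | succ n =>
      have := ih (n := n) (by simpa [unary, List.replicate_succ] using h)
      exact ⟨by rw [this.1], this.2⟩

theorem matrixBits_inj {n : ℕ} {M N : Fin n → Fin n → Bool} (h : matrixBits M = matrixBits N) :
    M = N := by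
  have h' := List.ofFn_injective h
  funext i j
  have := congrFun h' (finProdFinEquiv (i, j))
  have e := finProdFinEquiv.symm_apply_apply (i, j)
  simp only [finProdFinEquiv, Equiv.coe_fn_symm_mk, Equiv.coe_fn_mk, Prod.mk.injEq] at e this
  simpa [e.1, e.2] using this

theorem NodeKind.bits_injective : Function.Injective NodeKind.bits := by
  intro a b h
  cases a <;> cases b <;> simp_all [NodeKind.bits]

theorem Circuit.encode_injective : Function.Injective Circuit.encode := by
  rintro ⟨m, k₁, w₁, o₁, _, _, _, _⟩ ⟨n, k₂, w₂, o₂, _, _, _, _⟩ h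
  simp only [Circuit.encode, List.append_assoc] at h
  obtain ⟨rfl, h⟩ := unary_append_inj h
  obtain ⟨h1, h⟩ := List.append_inj h (by simp)
  obtain ⟨h2, h⟩ := List.append_inj h (by simp)
  obtain ⟨h3, h4⟩ := List.append_inj h (by simp)
  have hk : k₁ = k₂ := by
    funext i
    exact NodeKind.bits_injective
      (Prod.ext (congrFun (List.ofFn_injective h1) i) (congrFun (List.ofFn_injective h2) i))
  have ho : o₁ = o₂ := by
    have := congrFun (List.ofFn_injective h3) o₁
    simpa using this
  have hw : w₁ = w₂ := matrixBits_inj h4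
  subst hk ho hw
  rfl

/-! ### The W-hierarchy -/

structure WCSInst (t d : ℕ) where
  circuit : Circuit
  k : ℕ
  weft_le : circuit.WeftLE t
  depth_le : circuit.DepthLE d

/-- Weighted satisfiability of circuits of weft at most `t` and depth at most `d`: is there a
satisfying assignment of weight exactly `k`? The parameter is `k`. -/
def WCS (t d : ℕ) : ParamProblem where
  Inst := WCSInst t d
  encode I := I.circuit.encode
  param I := I.k
  encode_injective := by
    rintro ⟨C, k, _, _⟩ ⟨C', k', _, _⟩ h
    simp only [Prod.mk.injEq] at h
    obtain ⟨h, rfl⟩ := h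
    cases Circuit.encode_injective h
    rfl
  Yes I := I.circuit.WeightedSat I.k

/-- Membership in the class `W[t]`. -/
def InW (t : ℕ) (P : ParamProblem) : Prop := ∃ d, FPTReducible P (WCS t d)

/-- Hardness for the class `W[t]` under fpt-reductions. -/
def WHard (t : ℕ) (Q : ParamProblem) : Prop := ∀ P, InW t P → FPTReducible P Q

/-! ### Dominating Set on `t`-claw-free graphs -/

/-- The `t`-claw `K_{1,t}`. -/
abbrev claw (t : ℕ) : SimpleGraph (Fin 1 ⊕ Fin t) := completeBipartiteGraph (Fin 1) (Fin t)

/-- `G` has no induced subgraph isomorphic to the `t`-claw. -/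
def ClawFree {V : Type*} (t : ℕ) (G : SimpleGraph V) : Prop := ¬ (claw t).IsIndContained G

def IsDominatingSet {V : Type*} (G : SimpleGraph V) (D : Finset V) : Prop :=
  ∀ v, v ∉ D → ∃ u ∈ D, G.Adj v u

structure ClawFreeGraphInst (t : ℕ) where
  n : ℕ
  graph : SimpleGraph (Fin n)
  k : ℕ
  clawFree : ClawFree t graph

open Classical in
/-- Number of vertices in unary, followed by the adjacency matrix. -/
noncomputable def encodeGraph {n : ℕ} (G : SimpleGraph (Fin n)) : List Bool :=
  unary n ++ matrixBits fun i j => decide (G.Adj i j)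

/-- `k`-Dominating Set on `t`-claw-free graphs: is there a dominating set with at most `k` vertices?
The parameter is `k`. -/
noncomputable def dominatingSetClawFree (t : ℕ) : ParamProblem where
  Inst := ClawFreeGraphInst t
  encode I := encodeGraph I.graph
  param I := I.k
  encode_injective := by
    rintro ⟨n, G, k, _⟩ ⟨n', G', k', _⟩ h
    simp only [Prod.mk.injEq, encodeGraph] at h
    obtain ⟨h, rfl⟩ := h
    obtain ⟨rfl, h⟩ := unary_append_inj h
    have h := matrixBits_inj h
    have : G = G' := by
      ext i j
      simpa using congrFun (congrFun h i) j
    subst this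
    rfl
  Yes I := ∃ D : Finset (Fin I.n), D.card ≤ I.k ∧ IsDominatingSet I.graph D

end ParamComplexity

namespace ParamComplexity

open Polynomial

/-! ### Polynomial-time functions on the random access machine -/

/-! Weighted satisfiability of circuits of weft two and depth `d` is mapped in polynomial time (with
`k` counted in unary) to dominating sets; `FPTReducible.trans_polyFun` composes this map with any
given fpt-reduction to the circuit problem.

Graph. Suppose that a value out of `L` is to be chosen for each of `K` colours so as to hit given
sets of coloured values. `hittingGraph` has a clique of all coloured values, an independent set of
colours, each joined to its values, and a clique of sets, each joined to its members. The closed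
neighbourhoods of the `K` colours are disjoint, so `K` dominating vertices are one from each of
them, and the sets must be dominated by chosen values. Independent leaves of a star include at most
one vertex of each clique and at most one colour, since no vertex has two neighbours among the
colours: there are at most three leaves.

Local constraints. Let `X` assign letters to `m` positions, where constraint `j` asks for some
`r`-tuple `q` of positions such that `R j` holds of `q` and the letters at `q`. Take the tuples `q`
as colours and the `r`-tuples of letters as values; further sets make the chosen values agree with a
single `X` (`localMem_hitting_iff`). There are `m ^ r` colours, a number that depends only on `k`
and `d`.

Circuit. `X` lists the `k` true inputs in increasing order between two sentinels, followed by a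
strategy of a prover in the evaluation game. The prover commits to moves at the first large gate of
a path; the strategies of the refuter index the constraints; at the second large gate the prover may
move knowing the refuter's strategy, so this move is a quantifier inside the constraint
(`win_iff_of_weft_two`). Small gates only branch into two subgames, so at most `2 ^ d` inputs are
consulted. Each is certified by two positions of `X`: an input is true if it occurs, and false if it
lies strictly between two consecutive entries (`literalCert_iff`). Hence `2 ^ (d + 1)` positions
certify the whole game (`win_certificate`), and three more check the shape of `X`. -/

theorem Store.set_same (s : Store) (a i v : ℕ) : s.set a i v a i = v := by simp [Store.set]

theorem Store.set_cell_ne (s : Store) (a : ℕ) {i j : ℕ} (v b : ℕ) (h : j ≠ i) :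
    s.set a i v b j = s b j := by simp [Store.set, h]

theorem Store.set_array_ne (s : Store) {a b : ℕ} (i v j : ℕ) (h : b ≠ a) :
    s.set a i v b j = s b j := by simp [Store.set, h]

/-- A counted loop: `Inv i` holds before the `i`-th round, and the test fails after `n` rounds. -/
theorem Run.counted {p : Prog} {e : Expr} (Inv : ℕ → Store → Prop) (n B : ℕ)
    (htest : ∀ i s, i ≤ n → Inv i s → (e.eval s = 0 ↔ i = n))
    (hbody : ∀ i s, i < n → Inv i s → ∃ s' T, Run p s s' T ∧ Inv (i + 1) s' ∧ T ≤ B)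
    (s : Store) (hs : Inv 0 s) :
    ∃ s' T, Run (.loop e p) s s' T ∧ Inv n s' ∧ T ≤ n * (B + 1) + 1 := by
  have key : ∀ r i s, i + r = n → Inv i s →
      ∃ s' T, Run (.loop e p) s s' T ∧ Inv n s' ∧ T ≤ r * (B + 1) + 1 := by
    intro r
    induction r with
    | zero =>
      intro i s hi hs
      obtain rfl : i = n := by omega
      exact ⟨s, 1, .loop_false ((htest _ s le_rfl hs).2 rfl), hs, by omega⟩
    | succ r ih =>
      intro i s hi hs
      obtain ⟨s₁, T₁, h₁, hI, hT₁⟩ := hbody i s (by omega) hs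
      obtain ⟨s₂, T₂, h₂, hn, hT₂⟩ := ih (i + 1) s₁ (by omega) hI
      refine ⟨s₂, T₁ + T₂ + 1, .loop_true ?_ h₁ h₂, hn, ?_⟩
      · rw [Ne, htest i s (by omega) hs]
        omega
      · rw [Nat.succ_mul]
        omega
  exact key n 0 s (by omega) hs

/-- A type of contexts for computations: an input (a bit string and a parameter) and finitely
many numerical variables, the first two of which are the length of the string and the
parameter. -/
class Context (α : Type) where
  base : α → List Bool × ℕ
  width : ℕ
  var : α → ℕ → ℕ
  two_le_width : 2 ≤ width
  var_zero : ∀ a, var a 0 = (base a).1.length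
  var_one : ∀ a, var a 1 = (base a).2

namespace Context

instance : Context (List Bool × ℕ) where
  base a := a
  width := 2
  var a j := if j = 0 then a.1.length else a.2
  two_le_width := le_rfl
  var_zero _ := by simp
  var_one _ := by simp

/-- The additional variable acts as a bound variable: bounded sums and quantifiers over a context
`α` have their bodies on `α × ℕ`. -/
instance {α : Type} [Context α] : Context (α × ℕ) where
  base a := base a.1
  width := width α + 1
  var a j := if j = width α then a.2 else var a.1 j
  two_le_width := two_le_width.trans (Nat.le_succ _)
  var_zero a := by
    have := two_le_width (α := α)
    rw [if_neg (by omega), var_zero]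
  var_one a := by
    have := two_le_width (α := α)
    rw [if_neg (by omega), var_one]

/-- The variables of `a` are bounded by `M`. -/
def Bounded {α : Type} [Context α] (a : α) (M : ℕ) : Prop := ∀ j < width α, var a j ≤ M

/-- The context `a` is stored: variable `j` in cell `pos j` of array `o`, the input string in
array `o + 1`. -/
structure Stored {α : Type} [Context α] (o : ℕ) (pos : ℕ → ℕ) (s : Store) (a : α) : Prop where
  vars : ∀ j < width α, s o (pos j) = var a j
  input : ∀ i, s (o + 1) i = tape (base a).1 i

theorem Stored.congr {α : Type} [Context α] {o sp : ℕ} {pos : ℕ → ℕ} {s s' : Store} {a : α}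
    (h : Stored o pos s a) (hpos : ∀ j < width α, pos j < sp)
    (hs : ∀ b i, (b ≠ o ∨ i < sp) → s' b i = s b i) : Stored o pos s' a :=
  ⟨fun j hj => by rw [hs _ _ (.inr (hpos j hj)), h.vars j hj],
    fun i => by rw [hs _ _ (.inl (by omega)), h.input]⟩

end Context

open Context

variable {α : Type} [Context α]

/-- The program `p` computes `f` into cell `sp` of array `o`, changes no cells but those from `sp`
onwards in this array, and takes time bounded by `P`. -/
def Computes (f : α → ℕ) (P : ℕ[X]) (o : ℕ) (pos : ℕ → ℕ) (sp : ℕ) (p : Prog) : Prop :=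
  ∀ s a M, Stored o pos s a → Bounded a M → ∃ s' T, Run p s s' T ∧ s' o sp = f a ∧
    (∀ b i, (b ≠ o ∨ i < sp) → s' b i = s b i) ∧ T ≤ P.eval M

/-- Functions of a context with polynomially bounded values that are computable in polynomial time,
whatever the place of the variables in the memory. -/
def PolyFun (f : α → ℕ) : Prop :=
  ∃ P : ℕ[X], (∀ a M, Bounded a M → f a ≤ P.eval M) ∧
    ∀ o pos sp, (∀ j < width α, pos j < sp) → ∃ p, Computes f P o pos sp p

/-! ### Closure properties of polynomial-time functions -/

namespace PolyFun

theorem of_expr {f : α → ℕ} (P : ℕ[X]) (hP : ∀ a M, Bounded a M → f a ≤ P.eval M)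
    (h : ∀ o pos, ∃ e : Expr, ∀ s a, Stored o pos s a → e.eval s = f a) : PolyFun f := by
  refine ⟨P + 1, fun a M ha => (hP a M ha).trans (by simp), fun o pos sp hpos => ?_⟩
  obtain ⟨e, he⟩ := h o pos
  refine ⟨.write o (.const sp) e, fun s a M hs ha => ⟨_, _, .write _ _ _ _, ?_, ?_, ?_⟩⟩
  · simp [Expr.eval, Store.set_same, he s a hs]
  · rintro b i (h | h)
    · exact Store.set_array_ne _ _ _ _ h
    · exact Store.set_cell_ne _ _ _ _ (by simp only [Expr.eval]; omega)
  · simp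

theorem const (c : ℕ) : PolyFun fun _ : α => c :=
  of_expr (C c) (by simp) fun _ _ => ⟨.const c, fun _ _ _ => rfl⟩

theorem var {j : ℕ} (hj : j < width α) : PolyFun fun a : α => var a j :=
  of_expr X (fun a M h => by simpa using h j hj)
    fun o pos => ⟨.read o (.const (pos j)), fun s a hs => hs.vars j hj⟩

theorem length : PolyFun fun a : α => (base a).1.length := by
  have := var (α := α) (j := 0) (by have := two_le_width (α := α); omega)
  simpa only [var_zero] using this

theorem param : PolyFun fun a : α => (base a).2 := by
  have := var (α := α) (j := 1) (by have := two_le_width (α := α); omega)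
  simpa only [var_one] using this

theorem snd : PolyFun fun a : α × ℕ => a.2 := by
  have := var (α := α × ℕ) (j := width α) (Nat.lt_succ_self _)
  simpa [Context.var] using this

theorem lift {f : α → ℕ} (hf : PolyFun f) : PolyFun fun a : α × ℕ => f a.1 := by
  obtain ⟨P, hP, h⟩ := hf
  have hb : ∀ (a : α × ℕ) M, Bounded a M → Bounded a.1 M := fun a M ha j hj => by
    have := ha j (Nat.lt_succ_of_lt hj)
    rwa [show Context.var a j = Context.var a.1 j from if_neg (by omega)] at this
  refine ⟨P, fun a M ha => hP _ M (hb a M ha), fun o pos sp hpos => ?_⟩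
  obtain ⟨p, hp⟩ := h o pos sp fun j hj => hpos j (Nat.lt_succ_of_lt hj)
  refine ⟨p, fun s a M hs ha => hp s a.1 M ⟨fun j hj => ?_, hs.input⟩ (hb a M ha)⟩
  rw [hs.vars j (Nat.lt_succ_of_lt hj)]
  exact if_neg (by omega)

theorem tape_le (x : List Bool) (i : ℕ) : tape x i ≤ 2 := by
  unfold tape
  split <;> omega

theorem tape {f : α → ℕ} (hf : PolyFun f) : PolyFun fun a => tape (base a).1 (f a) := by
  obtain ⟨P, hP, h⟩ := hf
  refine ⟨P + 2, fun a M _ => (tape_le _ _).trans (by simp), fun o pos sp hpos => ?_⟩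
  obtain ⟨p, hp⟩ := h o pos sp hpos
  refine ⟨.seq p (.write o (.const sp) (.read (o + 1) (.read o (.const sp)))),
    fun s a M hs ha => ?_⟩
  obtain ⟨s', T, hr, hv, hfr, hT⟩ := hp s a M hs ha
  have hs' := hs.congr hpos hfr
  refine ⟨_, _, .seq hr (.write _ _ _ _), ?_, ?_, ?_⟩
  · simp [Expr.eval, Store.set_same, hv, hs'.input]
  · rintro b i h
    rw [← hfr b i h]
    rcases h with h | h
    · exact Store.set_array_ne _ _ _ _ h
    · exact Store.set_cell_ne _ _ _ _ (by simp only [Expr.eval]; omega)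
  · simp only [eval_add, eval_ofNat]
    omega

/-- The second argument is computed one cell higher, so that the first result survives in cell `sp`.
The bound `hop` keeps the values polynomial. -/
theorem binary {f g : α → ℕ} (hf : PolyFun f) (hg : PolyFun g) (op : ℕ → ℕ → ℕ)
    (hop : ∀ m n, op m n ≤ m + n) (E : Expr → Expr → Expr)
    (hE : ∀ s e₁ e₂, (E e₁ e₂).eval s = op (e₁.eval s) (e₂.eval s)) :
    PolyFun fun a => op (f a) (g a) := by
  obtain ⟨P, hP, hp⟩ := hf
  obtain ⟨Q, hQ, hq⟩ := hg
  refine ⟨P + Q + 1, fun a M ha => (hop _ _).trans ?_, fun o pos sp hpos => ?_⟩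
  · have := hP a M ha
    have := hQ a M ha
    simp only [eval_add, eval_one]
    omega
  obtain ⟨p, hp⟩ := hp o pos sp hpos
  obtain ⟨q, hq⟩ := hq o pos (sp + 1) fun j hj => Nat.lt_succ_of_lt (hpos j hj)
  refine ⟨.seq (.seq p q) (.write o (.const sp)
    (E (.read o (.const sp)) (.read o (.const (sp + 1))))), fun s a M hs ha => ?_⟩
  obtain ⟨s₁, T₁, hr₁, hv₁, hfr₁, hT₁⟩ := hp s a M hs ha
  obtain ⟨s₂, T₂, hr₂, hv₂, hfr₂, hT₂⟩ := hq s₁ a M (hs.congr hpos hfr₁) ha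
  refine ⟨_, _, .seq (.seq hr₁ hr₂) (.write _ _ _ _), ?_, ?_, ?_⟩
  · have := hfr₂ o sp (.inr (Nat.lt_succ_self _))
    simp [Expr.eval, Store.set_same, hE, hv₂, this, hv₁]
  · rintro b i h
    rw [← hfr₁ b i h, ← hfr₂ b i (h.imp_right Nat.lt_succ_of_lt)]
    rcases h with h | h
    · exact Store.set_array_ne _ _ _ _ h
    · exact Store.set_cell_ne _ _ _ _ (by simp only [Expr.eval]; omega)
  · simp only [eval_add, eval_one]
    omega

theorem add {f g : α → ℕ} (hf : PolyFun f) (hg : PolyFun g) : PolyFun fun a => f a + g a :=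
  hf.binary hg (· + ·) (fun _ _ => le_rfl) .add fun _ _ _ => rfl

theorem sub {f g : α → ℕ} (hf : PolyFun f) (hg : PolyFun g) : PolyFun fun a => f a - g a :=
  hf.binary hg (· - ·) (fun m n => (Nat.sub_le m n).trans (Nat.le_add_right m n)) .sub fun _ _ _ => rfl

theorem bounded_prod {P : ℕ[X]} {f : α → ℕ} (hP : ∀ a M, Bounded a M → f a ≤ P.eval M) {a : α}
    {M : ℕ} (ha : Bounded a M) {i : ℕ} (hi : i < f a) : Bounded (a, i) ((X + P).eval M) := by
  intro j hj
  have h1 := hP a M ha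
  simp only [Context.var, eval_add, eval_X]
  split_ifs with h
  · omega
  · have := ha j (by simp only [Context.width] at hj; omega)
    omega

/-- Cell `sp` holds the number of rounds, `sp + 1` the counter (which is also the new variable), `sp
+ 2` the partial sum, and the summand is computed from `sp + 3` on. This one loop is the source of
products, bounded quantifiers and division. -/
theorem sum {f : α → ℕ} {g : α × ℕ → ℕ} (hf : PolyFun f) (hg : PolyFun g) :
    PolyFun fun a => ∑ i ∈ Finset.range (f a), g (a, i) := by
  obtain ⟨P, hP, hp⟩ := hf
  obtain ⟨Q, hQ, hq⟩ := hg
  -- In the context `(a, i)` the variables, including the counter, are bounded by the value of `X +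
  -- P` at `M`.
  set Q' : ℕ[X] := Q.comp (X + P) with hQ'
  refine ⟨P * (Q' + 3) + P + 4, fun a M ha => ?_, fun o pos sp hpos => ?_⟩
  · calc ∑ i ∈ Finset.range (f a), g (a, i) ≤ ∑ i ∈ Finset.range (f a), Q'.eval M := by
          refine Finset.sum_le_sum fun i hi => ?_
          have := hQ (a, i) _ (bounded_prod hP ha (Finset.mem_range.1 hi))
          simpa [hQ', eval_comp] using this
      _ = f a * Q'.eval M := by simp
      _ ≤ P.eval M * Q'.eval M := Nat.mul_le_mul_right _ (hP a M ha)
      _ ≤ _ := by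
        simp only [eval_add, eval_mul, eval_ofNat]
        nlinarith
  obtain ⟨p, hp⟩ := hp o pos sp hpos
  let pos' : ℕ → ℕ := fun j => if j = width α then sp + 1 else pos j
  have hpos' : ∀ j < width (α × ℕ), pos' j < sp + 3 := fun j hj => by
    simp only [pos']
    split_ifs with h
    · omega
    · have := hpos j (by simp only [Context.width] at hj; omega)
      omega
  obtain ⟨q, hq⟩ := hq o pos' (sp + 3) hpos'
  let cell : ℕ → Expr := fun i => .read o (.const (sp + i))
  refine ⟨.seq p (.seq (.write o (.const (sp + 1)) (.const 0)) (.seq (.write o (.const (sp + 2))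
    (.const 0)) (.seq (.loop (.sub (cell 0) (cell 1)) (.seq q (.seq
      (.write o (.const (sp + 2)) (.add (cell 2) (cell 3)))
      (.write o (.const (sp + 1)) (.add (cell 1) (.const 1))))))
    (.write o (.const sp) (cell 2))))), fun s a M hs ha => ?_⟩
  obtain ⟨s₁, T₁, hr₁, hv₁, hfr₁, hT₁⟩ := hp s a M hs ha
  let s₂ := (s₁.set o (sp + 1) 0).set o (sp + 2) 0
  let Inv : ℕ → Store → Prop := fun i s' => s' o sp = f a ∧ s' o (sp + 1) = i ∧
    s' o (sp + 2) = ∑ i ∈ Finset.range i, g (a, i) ∧ ∀ b i, (b ≠ o ∨ i < sp) → s' b i = s b i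
  have hloop := Run.counted (e := .sub (cell 0) (cell 1)) (p := .seq q (.seq
      (.write o (.const (sp + 2)) (.add (cell 2) (cell 3)))
      (.write o (.const (sp + 1)) (.add (cell 1) (.const 1))))) Inv (f a) (Q'.eval M + 2) ?_ ?_ s₂ ?_
  · obtain ⟨s₃, T₃, hr₃, ⟨-, -, hv₃, hfr₃⟩, hT₃⟩ := hloop
    refine ⟨_, _, .seq hr₁ (.seq (.write _ _ _ _) (.seq (.write _ _ _ _)
      (.seq hr₃ (.write _ _ _ _)))), ?_, ?_, ?_⟩
    · simp [Expr.eval, Store.set_same, cell, hv₃]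
    · rintro b i h
      rw [← hfr₃ b i h]
      rcases h with h | h
      · exact Store.set_array_ne _ _ _ _ h
      · exact Store.set_cell_ne _ _ _ _ (by simp only [Expr.eval]; omega)
    · have := Nat.mul_le_mul_right (Q'.eval M + 3) (hP a M ha)
      rw [show Q'.eval M + 2 + 1 = Q'.eval M + 3 from rfl] at hT₃
      simp only [eval_add, eval_mul, eval_ofNat]
      omega
  · rintro i s' hi ⟨h0, h1, -⟩
    simp only [Expr.eval, cell, add_zero, h0, h1]
    omega
  · rintro i s' hi ⟨h0, h1, h2, hfr⟩
    have hst : Stored o pos' s' (a, i) := by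
      refine ⟨fun j hj => ?_, fun i => ?_⟩
      · simp only [pos', Context.var]
        split_ifs with h
        · exact h1
        · exact (hs.congr hpos hfr).vars j (by simp only [Context.width] at hj; omega)
      · rw [hfr _ _ (.inl (by omega))]
        exact hs.input i
    obtain ⟨s₄, T₄, hr₄, hv₄, hfr₄, hT₄⟩ := hq s' (a, i) _ hst (bounded_prod hP ha hi)
    refine ⟨_, _, .seq hr₄ (.seq (.write _ _ _ _) (.write _ _ _ _)), ⟨?_, ?_, ?_, ?_⟩, ?_⟩
    · simp [Expr.eval, Store.set, hfr₄ o sp (.inr (by omega)), h0]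
    · simp [Expr.eval, Store.set, cell, hfr₄ o (sp + 1) (.inr (by omega)), h1]
    · simp [Expr.eval, Store.set, cell, hfr₄ o (sp + 2) (.inr (by omega)), h2, hv₄,
        Finset.sum_range_succ]
    · intro b j hbj
      rw [← hfr b j hbj, ← hfr₄ b j (hbj.imp_right (by omega))]
      have h1 : ¬ (b = o ∧ j = sp + 1) := by omega
      have h2 : ¬ (b = o ∧ j = sp + 2) := by omega
      simp [Expr.eval, Store.set, h1, h2]
    · rw [← eval_comp, ← hQ'] at hT₄
      omega
  · refine ⟨?_, ?_, ?_, ?_⟩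
    · simp [s₂, Store.set, hv₁]
    · simp [s₂, Store.set]
    · simp [s₂, Store.set]
    · intro b j hbj
      rw [← hfr₁ b j hbj]
      simp only [s₂, Store.set]
      rw [if_neg (by omega), if_neg (by omega)]

theorem mul {f g : α → ℕ} (hf : PolyFun f) (hg : PolyFun g) : PolyFun fun a => f a * g a := by
  simpa using hf.sum hg.lift

theorem pow {f : α → ℕ} (hf : PolyFun f) (c : ℕ) : PolyFun fun a => f a ^ c := by
  induction c with
  | zero => simpa using const (α := α) 1
  | succ c ih => simpa only [pow_succ] using ih.mul hf

end PolyFun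

open Classical in
/-- Polynomial-time decidable predicates of a context. -/
def PolyPred (p : α → Prop) : Prop := PolyFun fun a => if p a then 1 else 0

/-! ### Closure properties of polynomial-time predicates -/

namespace PolyPred

theorem indicator {p : α → Prop} [DecidablePred p] (hp : PolyPred p) :
    PolyFun fun a => if p a then 1 else 0 := by
  unfold PolyPred at hp
  convert hp

theorem of_iff {p q : α → Prop} (hp : PolyPred p) (h : ∀ a, q a ↔ p a) : PolyPred q := by
  rwa [show q = p from funext fun a => propext (h a)]

theorem of_ne_zero {f : α → ℕ} (hf : PolyFun f) : PolyPred fun a => f a ≠ 0 := by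
  -- With truncated subtraction, `1 - (1 - n)` is the indicator of `n ≠ 0`.
  have := (PolyFun.const (α := α) 1).sub ((PolyFun.const 1).sub hf)
  unfold PolyPred
  convert this using 2 with a
  split_ifs <;> omega

theorem lift {p : α → Prop} (hp : PolyPred p) : PolyPred fun a : α × ℕ => p a.1 :=
  PolyFun.lift hp

theorem const (p : Prop) : PolyPred fun _ : α => p := PolyFun.const _

theorem not {p : α → Prop} (hp : PolyPred p) : PolyPred fun a => ¬ p a := by
  have := (PolyFun.const (α := α) 1).sub hp
  unfold PolyPred
  convert this using 2 with a
  by_cases h : p a <;> simp [h]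

theorem and {p q : α → Prop} (hp : PolyPred p) (hq : PolyPred q) :
    PolyPred fun a => p a ∧ q a := by
  have := PolyFun.mul hp hq
  unfold PolyPred
  convert this using 2 with a
  by_cases h1 : p a <;> by_cases h2 : q a <;> simp [h1, h2]

theorem or {p q : α → Prop} (hp : PolyPred p) (hq : PolyPred q) :
    PolyPred fun a => p a ∨ q a :=
  (hp.not.and hq.not).not.of_iff fun _ => by tauto

theorem imp {p q : α → Prop} (hp : PolyPred p) (hq : PolyPred q) :
    PolyPred fun a => p a → q a :=
  (hp.not.or hq).of_iff fun _ => imp_iff_not_or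

theorem iff {p q : α → Prop} (hp : PolyPred p) (hq : PolyPred q) :
    PolyPred fun a => p a ↔ q a :=
  ((hp.imp hq).and (hq.imp hp)).of_iff fun _ => iff_iff_implies_and_implies

theorem lt {f g : α → ℕ} (hf : PolyFun f) (hg : PolyFun g) : PolyPred fun a => f a < g a :=
  (of_ne_zero (hg.sub hf)).of_iff fun _ => by omega

theorem le {f g : α → ℕ} (hf : PolyFun f) (hg : PolyFun g) : PolyPred fun a => f a ≤ g a :=
  (lt hg hf).not.of_iff fun _ => by omega

theorem eq {f g : α → ℕ} (hf : PolyFun f) (hg : PolyFun g) : PolyPred fun a => f a = g a :=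
  ((le hf hg).and (le hg hf)).of_iff fun _ => by omega

theorem ne {f g : α → ℕ} (hf : PolyFun f) (hg : PolyFun g) : PolyPred fun a => f a ≠ g a :=
  (eq hf hg).not

/-- A bounded existential statement says that a sum of indicators is not zero. -/
theorem exists_lt {f : α → ℕ} {p : α → ℕ → Prop} (hf : PolyFun f)
    (hp : PolyPred fun a : α × ℕ => p a.1 a.2) : PolyPred fun a => ∃ i < f a, p a i :=
  (of_ne_zero (hf.sum hp)).of_iff fun a => by simp

theorem forall_lt {f : α → ℕ} {p : α → ℕ → Prop} (hf : PolyFun f)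
    (hp : PolyPred fun a : α × ℕ => p a.1 a.2) : PolyPred fun a => ∀ i < f a, p a i :=
  (exists_lt (p := fun a i => ¬ p a i) hf hp.not).not.of_iff fun a => by simp

/-- Here `i` is not a variable of the machine: each `p i` has its own program. This serves where `i`
is an exponent, since `PolyFun.pow` allows constant exponents only. -/
theorem forall_lt_const {p : ℕ → α → Prop} (r : ℕ) (hp : ∀ i < r, PolyPred (p i)) :
    PolyPred fun a => ∀ i < r, p i a := by
  induction r with
  | zero => exact (const True).of_iff fun a => by simp
  | succ r ih =>
    exact ((ih fun i hi => hp i (by omega)).and (hp r (by omega))).of_iff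
      fun a => Nat.forall_lt_succ_right

end PolyPred

namespace PolyFun

theorem ite {p : α → Prop} [DecidablePred p] {f g : α → ℕ} (hp : PolyPred p) (hf : PolyFun f)
    (hg : PolyFun g) :
    PolyFun fun a => if p a then f a else g a := by
  have := (mul hp hf).add (mul hp.not hg)
  convert this using 2 with a
  by_cases h : p a <;> simp [h]

/-- For `g a > 0` the quotient is the number of `i < f a` with `(i + 1) * g a ≤ f a`. -/
theorem div {f g : α → ℕ} (hf : PolyFun f) (hg : PolyFun g) : PolyFun fun a => f a / g a := by
  have := ite (PolyPred.eq hg (const 0)) (const 0) (hf.sum (g := fun a : α × ℕ =>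
    if (a.2 + 1) * g a.1 ≤ f a.1 then 1 else 0)
    (PolyPred.le ((snd.add (const 1)).mul hg.lift) hf.lift).indicator)
  convert this using 2 with a
  split_ifs with h
  · simp [h]
  · have hpos := Nat.pos_of_ne_zero h
    have : (Finset.range (f a)).filter (fun i => (i + 1) * g a ≤ f a) =
        Finset.range (f a / g a) := by
      ext i
      simp only [Finset.mem_filter, Finset.mem_range, ← Nat.le_div_iff_mul_le hpos]
      have := Nat.div_le_self (f a) (g a)
      omega
    rw [← Finset.sum_filter, this]
    simp

theorem mod {f g : α → ℕ} (hf : PolyFun f) (hg : PolyFun g) : PolyFun fun a => f a % g a := by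
  have := hf.sub (hg.mul (hf.div hg))
  simpa only [← Nat.mod_eq_sub_mul_div] using this

end PolyFun

end ParamComplexity

namespace ParamComplexity

open Polynomial Context

/-! ### Composition with an fpt-reduction -/

/-- All arrays that occur in assignments of the program have numbers below this bound. -/
def Prog.arrayBound : Prog → ℕ
  | .skip => 0
  | .write a _ _ => a + 1
  | .seq p q => max p.arrayBound q.arrayBound
  | .ite _ p q => max p.arrayBound q.arrayBound
  | .loop _ p => p.arrayBound

/-- Array numbers are literals of the program text and only cell indices are computed, so a program
writes to the arrays it names and to no others. This leaves blank arrays for a second program. -/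
theorem Run.frame {p : Prog} {s s' : Store} {T : ℕ} (h : Run p s s' T) {b : ℕ}
    (hb : p.arrayBound ≤ b) (i : ℕ) : s' b i = s b i := by
  induction h with
  | skip => rfl
  | write s a =>
    exact Store.set_array_ne _ _ _ _ (by simp only [Prog.arrayBound] at hb; omega)
  | seq _ _ ih₁ ih₂ =>
    simp only [Prog.arrayBound, max_le_iff] at hb
    rw [ih₂ hb.2, ih₁ hb.1]
  | ite_true _ _ ih =>
    simp only [Prog.arrayBound, max_le_iff] at hb
    exact ih hb.1
  | ite_false _ _ ih =>
    simp only [Prog.arrayBound, max_le_iff] at hb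
    exact ih hb.2
  | loop_true _ _ _ ih₁ ih₂ =>
    rw [ih₂ hb]
    exact ih₁ hb
  | loop_false => rfl

/-- A run of `T` steps fills at most `T` cells. -/
theorem Run.exists_filled {p : Prog} {s s' : Store} {T : ℕ} (h : Run p s s' T) (b : ℕ) :
    ∃ W : Finset ℕ, W.card ≤ T ∧ ∀ i, s' b i ≠ 0 → s b i ≠ 0 ∨ i ∈ W := by
  induction h with
  | skip => exact ⟨∅, by simp, fun i hi => .inl hi⟩
  | write s a i e =>
    refine ⟨{i.eval s}, by simp, fun j hj => ?_⟩
    by_cases h : j = i.eval s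
    · simp [h]
    · rw [Store.set_cell_ne _ _ _ _ h] at hj
      exact .inl hj
  | seq _ _ ih₁ ih₂ =>
    obtain ⟨W₁, h₁, h₁'⟩ := ih₁
    obtain ⟨W₂, h₂, h₂'⟩ := ih₂
    refine ⟨W₁ ∪ W₂, (Finset.card_union_le _ _).trans (by omega), fun i hi => ?_⟩
    simp only [Finset.mem_union]
    rcases h₂' i hi with h | h
    · rcases h₁' i h with h | h <;> tauto
    · tauto
  | ite_true _ _ ih => exact ih.imp fun W hW => ⟨by omega, hW.2⟩
  | ite_false _ _ ih => exact ih.imp fun W hW => ⟨by omega, hW.2⟩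
  | loop_true _ _ _ ih₁ ih₂ =>
    obtain ⟨W₁, h₁, h₁'⟩ := ih₁
    obtain ⟨W₂, h₂, h₂'⟩ := ih₂
    refine ⟨W₁ ∪ W₂, (Finset.card_union_le _ _).trans (by omega), fun i hi => ?_⟩
    simp only [Finset.mem_union]
    rcases h₂' i hi with h | h
    · rcases h₁' i h with h | h <;> tauto
    · tauto
  | loop_false => exact ⟨∅, by simp, fun i hi => .inl hi⟩

theorem tape_eq_zero_iff {x : List Bool} {i : ℕ} : tape x i = 0 ↔ x.length ≤ i := by
  unfold tape
  rw [← List.getElem?_eq_none_iff]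
  split <;> simp_all

/-- Every nonblank cell of the output either belonged to the input or was filled during the run. -/
theorem length_le_of_run {p : Prog} {x y : List Bool} {k l T : ℕ} {s : Store}
    (h : Run p (initStore x k) s T) (hy : HasOutput s y l) : y.length ≤ x.length + T := by
  obtain ⟨W, hW, hW'⟩ := h.exists_filled 0
  have : Finset.range y.length ⊆ Finset.range x.length ∪ W := by
    intro i hi
    rw [Finset.mem_range] at hi
    have h0 : s 0 i ≠ 0 := by
      rw [hy.1 i hi.le, Ne, tape_eq_zero_iff]
      omega
    rcases hW' i h0 with h | h
    · simp only [initStore, if_true, Ne, tape_eq_zero_iff] at h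
      simp only [Finset.mem_union, Finset.mem_range]
      omega
    · exact Finset.mem_union_right _ h
  have := (Finset.card_le_card this).trans (Finset.card_union_le _ _)
  simp only [Finset.card_range] at this
  omega

/-- The program that copies the input string to array `o + 1`, and its length and the parameter to
the first two cells of array `o`. -/
def copyInput (o : ℕ) : Prog :=
  .seq (.loop (.read 0 (.read o (.const 0)))
    (.seq (.write (o + 1) (.read o (.const 0)) (.read 0 (.read o (.const 0))))
      (.write o (.const 0) (.add (.read o (.const 0)) (.const 1)))))
    (.write o (.const 1) (.read 1 (.const 0)))

theorem run_copyInput {o : ℕ} (ho : 2 ≤ o) {s : Store} {x : List Bool} {k : ℕ}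
    (hx : HasOutput s x k) (hs : ∀ b ≥ o, ∀ i, s b i = 0) :
    ∃ s' T, Run (copyInput o) s s' T ∧ Stored o id s' (x, k) ∧ T ≤ 3 * x.length + 2 := by
  let Inv : ℕ → Store → Prop := fun i s' => s' o 0 = i ∧ (∀ b < o, ∀ j, s' b j = s b j) ∧
    ∀ j, s' (o + 1) j = if j < i then tape x j else 0
  obtain ⟨s₁, T₁, hr, ⟨h0, hfr, h1⟩, hT⟩ := Run.counted (e := .read 0 (.read o (.const 0)))
    (p := .seq (.write (o + 1) (.read o (.const 0)) (.read 0 (.read o (.const 0))))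
      (.write o (.const 0) (.add (.read o (.const 0)) (.const 1)))) Inv x.length 2
    (by
      rintro i s' hi ⟨h0, hfr, -⟩
      simp only [Expr.eval, h0]
      rw [hfr 0 (by omega), hx.1 i hi, tape_eq_zero_iff]
      omega)
    (by
      rintro i s' hi ⟨h0, hfr, h1⟩
      refine ⟨_, _, .seq (.write _ _ _ _) (.write _ _ _ _), ⟨?_, ?_, ?_⟩, le_rfl⟩
      · simp [Expr.eval, Store.set, h0]
      · intro b hb j
        have h1 : b ≠ o := by omega
        have h2 : b ≠ o + 1 := by omega
        simp [Store.set, h1, h2, hfr b hb j]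
      · intro j
        have h2 : s' 0 i = tape x i := by rw [hfr 0 (by omega), hx.1 i hi.le]
        simp only [Expr.eval, Store.set, h0, h1]
        by_cases hj : j = i
        · simp [hj, h2]
        · have : j < i + 1 ↔ j < i := by omega
          simp [hj, this])
    s ⟨hs o le_rfl 0, fun _ _ _ => rfl, fun j => by simp [hs (o + 1) (by omega) j]⟩
  -- The loop counter in cell `0` has stopped at the length of the string, as variable `0` requires.
  refine ⟨_, _, .seq hr (.write _ _ _ _), ⟨fun j hj => ?_, fun i => ?_⟩, by omega⟩
  · have hj : j = 0 ∨ j = 1 := by simp only [Context.width] at hj; omega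
    rcases hj with rfl | rfl
    · simp [Expr.eval, Store.set, h0, Context.var]
    · simp [Expr.eval, Store.set, Context.var, hfr 1 (by omega), hx.2]
  · rw [Store.set_array_ne _ _ _ _ (by omega), h1]
    simp only [Context.base]
    split_ifs with h
    · rfl
    · exact (tape_eq_zero_iff.2 (by omega)).symm

/-- Polynomial-time functions for the length and the bits of the output and for the new parameter
give a program that transforms its input in polynomial time, and that works on dirty memory as long
as the arrays from `o` on are empty. -/
theorem exists_transducer {len par : List Bool × ℕ → ℕ} {out : (List Bool × ℕ) × ℕ → ℕ}
    (hlen : PolyFun len) (hpar : PolyFun par) (hout : PolyFun out) :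
    ∃ S : ℕ[X], ∀ o ≥ 2, ∃ p, ∀ s x k, HasOutput s x k → (∀ b ≥ o, ∀ i, s b i = 0) →
      ∃ s' T, Run p s s' T ∧ (∀ i < len (x, k), s' 0 i = out ((x, k), i)) ∧
        s' 0 (len (x, k)) = 0 ∧ s' 1 0 = par (x, k) ∧ T ≤ S.eval (x.length + k) := by
  obtain ⟨P, hP, hp⟩ := hlen
  obtain ⟨Q, -, hq⟩ := hout
  obtain ⟨R, -, hr⟩ := hpar
  set Q' : ℕ[X] := Q.comp (X + P) with hQ'
  refine ⟨3 * X + P + P * (Q' + 3) + R + 10, fun o ho => ?_⟩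
  obtain ⟨p, hp⟩ := hp o id 2 (by simp [Context.width])
  -- Cell `2` keeps the length of the output, so the index of the output symbol (variable `2` for
  -- `out`) lives in cell `3`, and scratch space starts at cell `4`.
  obtain ⟨q, hq⟩ := hq o (fun j => if j = 2 then 3 else j) 4 (by
    intro j hj
    simp only [Context.width] at hj
    split_ifs <;> omega)
  obtain ⟨r, hr⟩ := hr o id 2 (by simp [Context.width])
  let cell : ℕ → Expr := fun i => .read o (.const i)
  -- Array `0` may be overwritten once its content has been copied. The blank written after the loop
  -- is needed because older symbols may remain beyond the new output.
  refine ⟨.seq (copyInput o) (.seq p (.seq (.write o (.const 3) (.const 0)) (.seq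
    (.loop (.sub (cell 2) (cell 3)) (.seq q (.seq (.write 0 (cell 3) (cell 4))
      (.write o (.const 3) (.add (cell 3) (.const 1))))))
    (.seq (.write 0 (cell 3) (.const 0)) (.seq r (.write 1 (.const 0) (cell 2))))))),
    fun s x k hx hs => ?_⟩
  obtain ⟨s₁, T₁, hr₁, hst₁, hT₁⟩ := run_copyInput ho hx hs
  have hbd : Bounded (x, k) (x.length + k) := by
    intro j hj
    simp only [Context.var]
    split_ifs <;> omega
  obtain ⟨s₂, T₂, hr₂, hv₂, hfr₂, hT₂⟩ := hp s₁ (x, k) _ hst₁ hbd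
  have hst₂ := hst₁.congr (sp := 2) (by simp [Context.width]) hfr₂
  let s₃ := s₂.set o 3 0
  let Inv : ℕ → Store → Prop := fun i s' => s' o 2 = len (x, k) ∧ s' o 3 = i ∧
    Stored o id s' (x, k) ∧ ∀ j < i, s' 0 j = out ((x, k), j)
  obtain ⟨s₄, T₄, hr₄, ⟨-, hi₄, hst₄, hout₄⟩, hT₄⟩ := Run.counted
    (e := .sub (cell 2) (cell 3)) (p := .seq q (.seq (.write 0 (cell 3) (cell 4))
      (.write o (.const 3) (.add (cell 3) (.const 1))))) Inv (len (x, k))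
    (Q'.eval (x.length + k) + 2) (by
      rintro i s' hi ⟨h2, h3, -, -⟩
      simp only [Expr.eval, cell, h2, h3]
      omega)
    (by
      rintro i s' hi ⟨h2, h3, hst, hj⟩
      obtain ⟨s₅, T₅, hr₅, hv₅, hfr₅, hT₅⟩ := hq s' ((x, k), i) _ (by
        refine ⟨fun j hj => ?_, hst.input⟩
        simp only [Context.var, Context.width]
        split_ifs with h1 h2
        · exact h3
        · simpa [Context.var, h2] using hst.vars j (by simp [h2, Context.width])
        · simpa [Context.var, h2] using hst.vars j (by simp only [Context.width] at *; omega)) (PolyFun.bounded_prod hP hbd hi)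
      rw [← eval_comp, ← hQ'] at hT₅
      have h3' : s₅ o 3 = i := by rw [hfr₅ _ _ (.inr (by omega)), h3]
      have ho0 : o ≠ 0 := by omega
      refine ⟨_, _, .seq hr₅ (.seq (.write _ _ _ _) (.write _ _ _ _)), ⟨?_, ?_, ⟨?_, ?_⟩, ?_⟩, ?_⟩
      · simp [Expr.eval, Store.set, hfr₅ o 2 (.inr (by omega)), h2, ho0]
      · simp [Expr.eval, Store.set, cell, h3', ho0]
      · intro j hj
        simp only [Context.width] at hj
        have hj3 : j ≠ 3 := by omega
        rw [← hst.vars j hj]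
        simp [Expr.eval, Store.set, hj3, ho0, hfr₅ o j (.inr (by omega))]
      · intro j
        rw [← hst.input j]
        simp [Store.set, hfr₅ (o + 1) j (.inl (by omega))]
      · intro j hj'
        simp only [Expr.eval, Store.set, cell, h3', ho0.symm, false_and, if_false, true_and]
        split_ifs with hji
        · rw [hv₅, hji]
        · rw [hfr₅ 0 j (.inl ho0.symm), hj j (by omega)]
      · omega)
    s₃ (by
      refine ⟨?_, ?_, ⟨?_, ?_⟩, by simp⟩
      · simp [s₃, Store.set, hv₂]
      · simp [s₃, Store.set]
      · intro j hj
        simp only [Context.width] at hj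
        rw [← hst₂.vars j hj]
        exact Store.set_cell_ne _ _ _ _ (by simp; omega)
      · intro j
        rw [← hst₂.input j]
        exact Store.set_array_ne _ _ _ _ (by omega))
  let s₆ := s₄.set 0 (s₄ o 3) 0
  obtain ⟨s₇, T₇, hr₇, hv₇, hfr₇, hT₇⟩ := hr s₆ (x, k) _ (by
    refine ⟨fun j hj => ?_, fun j => ?_⟩
    · rw [← hst₄.vars j hj]
      exact Store.set_array_ne _ _ _ _ (by omega)
    · rw [← hst₄.input j]
      exact Store.set_array_ne _ _ _ _ (by omega)) hbd
  refine ⟨_, _, .seq hr₁ (.seq hr₂ (.seq (.write _ _ _ _) (.seq hr₄ (.seq (.write _ _ _ _)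
    (.seq hr₇ (.write _ _ _ _)))))), ?_, ?_, ?_, ?_⟩
  · intro i hi
    rw [Store.set_array_ne _ _ _ _ (by omega), hfr₇ _ _ (.inl (by omega)), ← hout₄ i hi]
    exact Store.set_cell_ne _ _ _ _ (by omega)
  · rw [Store.set_array_ne _ _ _ _ (by omega), hfr₇ _ _ (.inl (by omega))]
    simp [s₆, Store.set, hi₄]
  · simp [Expr.eval, Store.set, cell, hv₇]
  · have h1 := Nat.mul_le_mul_right (Q'.eval (x.length + k) + 3) (hP (x, k) _ hbd)
    rw [show Q'.eval (x.length + k) + 2 + 1 = Q'.eval (x.length + k) + 3 from rfl] at hT₄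
    simp only [eval_add, eval_mul, eval_ofNat, eval_X]
    omega

/-- With one constant as both factor and exponent, the bounds for two summands combine by adding
their constants. -/
theorem exists_eval_le_pow (S : ℕ[X]) : ∃ c, ∀ M, S.eval M ≤ c * (M + 1) ^ c := by
  induction S using Polynomial.induction_on' with
  | add p q hp hq =>
    obtain ⟨a, ha⟩ := hp
    obtain ⟨b, hb⟩ := hq
    refine ⟨a + b, fun M => ?_⟩
    rw [eval_add, add_mul]
    exact add_le_add
      ((ha M).trans (Nat.mul_le_mul_left _ (Nat.pow_le_pow_right (by omega) (by omega))))
      ((hb M).trans (Nat.mul_le_mul_left _ (Nat.pow_le_pow_right (by omega) (by omega))))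
  | monomial n a =>
    refine ⟨a + n, fun M => ?_⟩
    rw [eval_monomial]
    exact Nat.mul_le_mul (by omega)
      ((Nat.pow_le_pow_left (by omega) n).trans (Nat.pow_le_pow_right (by omega) (by omega)))

theorem computable_mul_pow {f : ℕ → ℕ} (hf : Computable f) (a c : ℕ) :
    Computable fun k => a * f k ^ c := by
  have hmul {f g : ℕ → ℕ} (hf : Computable f) (hg : Computable g) :
      Computable fun k => f k * g k :=
    Computable.comp (f := fun x : ℕ × ℕ => x.1 * x.2) Primrec.nat_mul.to_comp (hf.pair hg)
  refine hmul (Computable.const a) ?_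
  induction c with
  | zero => simpa using Computable.const 1
  | succ c ih => simpa only [pow_succ] using hmul ih hf

theorem computable_add {f g : ℕ → ℕ} (hf : Computable f) (hg : Computable g) :
    Computable fun k => f k + g k :=
  Computable.comp (f := fun x : ℕ × ℕ => x.1 + x.2) Primrec.nat_add.to_comp (hf.pair hg)

/-- An fpt-reduction followed by a polynomial-time transformation. -/
theorem FPTReducible.trans_polyFun {P Q R : ParamProblem} (h : FPTReducible P Q)
    (F : Q.Inst → R.Inst) {len par : List Bool × ℕ → ℕ} {out : (List Bool × ℕ) × ℕ → ℕ}
    (hlen : PolyFun len) (hpar : PolyFun par) (hout : PolyFun out)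
    (h_len : ∀ I, (R.encode (F I)).length = len (Q.encode I, Q.param I))
    (h_out : ∀ I, ∀ i < len (Q.encode I, Q.param I),
      tape (R.encode (F I)) i = out ((Q.encode I, Q.param I), i))
    (h_par : ∀ I, R.param (F I) = par (Q.encode I, Q.param I))
    {g : ℕ → ℕ} (hg : Computable g) (hg_mono : Monotone g)
    (h_g : ∀ I, R.param (F I) ≤ g (Q.param I)) (h_yes : ∀ I, Q.Yes I ↔ R.Yes (F I)) :
    FPTReducible P R := by
  obtain ⟨F₁, p₁, f₁, g₁, c₁, hf₁, hg₁, hyes₁, hpar₁, hrun₁⟩ := h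
  obtain ⟨S, hS⟩ := exists_transducer hlen hpar hout
  obtain ⟨c, hc⟩ := exists_eval_le_pow S
  -- The second program works above every array that the first may have written, and above the
  -- arrays `0` and `1` used for input and output.
  obtain ⟨p₂, hp₂⟩ := hS (max 2 p₁.arrayBound) (le_max_left _ _)
  refine ⟨fun I => F (F₁ I), .seq p₁ p₂, fun k => f₁ k + c * (f₁ k + (g₁ k + 2)) ^ c,
    fun k => g (g₁ k), c₁ + (c₁ + 1) * c, ?_, hg.comp hg₁, fun I => (hyes₁ I).trans (h_yes _),
    fun I => (h_g _).trans (hg_mono (hpar₁ I)), fun I => ?_⟩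
  · exact computable_add hf₁ (computable_mul_pow
      (computable_add hf₁ (computable_add hg₁ (Computable.const 2))) c c)
  obtain ⟨s₁, T₁, hr₁, ho₁, hT₁⟩ := hrun₁ I
  obtain ⟨s₂, T₂, hr₂, hout₂, hblank, hpar₂, hT₂⟩ := hp₂ s₁ _ _ ho₁ (by
    intro b hb i
    rw [hr₁.frame ((le_max_right _ _).trans hb)]
    have : 2 ≤ b := (le_max_left _ _).trans hb
    simp only [initStore]
    rw [if_neg (by omega), if_neg (by omega)])
  refine ⟨s₂, _, .seq hr₁ hr₂, ⟨fun i hi => ?_, ?_⟩, ?_⟩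
  · rcases hi.lt_or_eq with hi | rfl
    · rw [h_len] at hi
      rw [hout₂ i hi, h_out _ i hi]
    · rw [tape_eq_zero_iff.2 le_rfl, h_len, hblank]
  · rw [hpar₂, h_par]
  · set k := P.param I
    set n := (P.encode I).length
    have hlen₁ : (Q.encode (F₁ I)).length ≤ n + T₁ := length_le_of_run hr₁ ho₁
    -- The intermediate instance has length at most `n + T₁`; one more factor `n + 1` absorbs the
    -- summand `n`.
    have hM : (Q.encode (F₁ I)).length + Q.param (F₁ I) + 1 ≤
        (f₁ k + (g₁ k + 2)) * (n + 1) ^ (c₁ + 1) := by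
      have h1 : 1 ≤ (n + 1) ^ c₁ := Nat.one_le_pow _ _ (by omega)
      have h2 : Q.param (F₁ I) ≤ g₁ k := hpar₁ I
      have h7 : T₁ ≤ f₁ k * (n + 1) ^ c₁ := hT₁
      have h3 : (f₁ k + (g₁ k + 2)) * (n + 1) ^ (c₁ + 1) =
        f₁ k * (n + 1) ^ c₁ * (n + 1) + g₁ k * ((n + 1) ^ c₁ * (n + 1)) +
          2 * ((n + 1) ^ c₁ * (n + 1)) := by ring
      have h4 : n + 1 ≤ (n + 1) ^ c₁ * (n + 1) := Nat.le_mul_of_pos_left _ h1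
      have h5 : f₁ k * (n + 1) ^ c₁ ≤ f₁ k * (n + 1) ^ c₁ * (n + 1) :=
        Nat.le_mul_of_pos_right _ (by omega)
      have h6 : g₁ k ≤ g₁ k * ((n + 1) ^ c₁ * (n + 1)) := Nat.le_mul_of_pos_right _ (by omega)
      rw [h3]
      omega
    have hT₂' : T₂ ≤ c * (f₁ k + (g₁ k + 2)) ^ c * (n + 1) ^ ((c₁ + 1) * c) := by
      refine (hT₂.trans (hc _)).trans ?_
      rw [mul_assoc, pow_mul, ← mul_pow]
      gcongr
    calc T₁ + T₂ ≤ f₁ k * (n + 1) ^ (c₁ + (c₁ + 1) * c) +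
          c * (f₁ k + (g₁ k + 2)) ^ c * (n + 1) ^ (c₁ + (c₁ + 1) * c) := by
          refine add_le_add (hT₁.trans ?_) (hT₂'.trans ?_)
          · exact Nat.mul_le_mul_left _ (Nat.pow_le_pow_right (by omega) (by omega))
          · exact Nat.mul_le_mul_left _ (Nat.pow_le_pow_right (by omega) (by omega))
      _ = _ := by ring

end ParamComplexity

namespace ParamComplexity

/-! ### From multicoloured hitting sets to claw-free graphs -/

/-- The adjacency relation of `hittingGraph`, one direction of each edge being enough. Vertices
below `K * L` are the pairs of a colour (below `K`) and a value (below `L`); then come the colours,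
and then the sets to be hit. -/
def hittingRel (K L : ℕ) (Mem : ℕ → ℕ → ℕ → Prop) (u v : ℕ) : Prop :=
  (u < K * L ∧ v < K * L) ∨
  (u < K * L ∧ (K * L ≤ v ∧ (v < K * L + K ∧ u / L = v - K * L))) ∨
  (u < K * L ∧ (K * L + K ≤ v ∧ Mem (v - (K * L + K)) (u / L) (u % L))) ∨
  (K * L + K ≤ u ∧ K * L + K ≤ v)

/-- The graph that has a dominating set with `K` vertices if one can choose a value for each of `K`
colours such that each of `m` sets of coloured values is hit. -/
def hittingGraph (K L m : ℕ) (Mem : ℕ → ℕ → ℕ → Prop) : SimpleGraph (Fin (K * L + K + m)) :=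
  SimpleGraph.fromRel fun u v => hittingRel K L Mem u v

variable {K L m : ℕ} {Mem : ℕ → ℕ → ℕ → Prop}

/-- A colour is adjacent only to its own values, so a neighbour determines it: no vertex has two
neighbours among the colours. -/
theorem hittingRel_of_colour {c u : ℕ} (h : hittingRel K L Mem c u ∨ hittingRel K L Mem u c)
    (h1 : K * L ≤ u) (h2 : u < K * L + K) : u = K * L + c / L := by
  rcases h with (h | h | h | h) | (h | h | h | h) <;> omega

/-- Coloured values form a clique, sets form a clique, and the colours adjacent to a given centre
coincide. Two leaves are distinct and nonadjacent, so they are of different types among these three.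
-/
theorem hittingGraph_clawFree {t : ℕ} (ht : 4 ≤ t) : ClawFree t (hittingGraph K L m Mem) := by
  rintro ⟨φ⟩
  let type : Fin (K * L + K + m) → Fin 3 := fun v =>
    if v.1 < K * L then 0 else if v.1 < K * L + K then 1 else 2
  have hinj : Function.Injective fun i : Fin t => type (φ (.inr i)) := by
    intro i j hij
    by_contra hne
    have hi : (hittingGraph K L m Mem).Adj (φ (.inl 0)) (φ (.inr i)) :=
      φ.map_rel_iff.2 (by simp [completeBipartiteGraph])
    have hj : (hittingGraph K L m Mem).Adj (φ (.inl 0)) (φ (.inr j)) :=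
      φ.map_rel_iff.2 (by simp [completeBipartiteGraph])
    have hn : ¬ (hittingGraph K L m Mem).Adj (φ (.inr i)) (φ (.inr j)) := fun h => by
      have := φ.map_rel_iff.1 h
      simp [completeBipartiteGraph] at this
    have hne' : φ (.inr i) ≠ φ (.inr j) := fun h => hne (by simpa using φ.injective h)
    simp only [hittingGraph, SimpleGraph.fromRel_adj] at hi hj hn
    have hn' := fun h => hn ⟨hne', .inl h⟩
    simp only [type] at hij
    by_cases hi1 : (φ (.inr i)).1 < K * L <;> by_cases hj1 : (φ (.inr j)).1 < K * L
    · exact hn' (.inl ⟨hi1, hj1⟩)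
    · by_cases hj2 : (φ (.inr j)).1 < K * L + K <;> simp [hi1, hj1, hj2] at hij
    · by_cases hi2 : (φ (.inr i)).1 < K * L + K <;> simp [hi1, hj1, hi2] at hij
    by_cases hi2 : (φ (.inr i)).1 < K * L + K <;> by_cases hj2 : (φ (.inr j)).1 < K * L + K
    · exact hne' (Fin.ext ((hittingRel_of_colour hi.2 (by omega) hi2).trans
        (hittingRel_of_colour hj.2 (by omega) hj2).symm))
    · simp [hi1, hj1, hi2, hj2] at hij
    · simp [hi1, hj1, hi2, hj2] at hij
    · exact hn' (.inr (.inr (.inr ⟨by omega, by omega⟩)))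
  have := Fintype.card_le_of_injective _ hinj
  simp at this
  omega

/-- Each colour is dominated by itself or by one of its values. This needs `K` different vertices,
so the dominating set contains nothing else; in particular it contains no set, and the sets have to
be hit by chosen values. -/
theorem hittingGraph_dominatingSet_iff (hL : 0 < L) :
    (∃ D : Finset (Fin (K * L + K + m)), D.card ≤ K ∧
      IsDominatingSet (hittingGraph K L m Mem) D) ↔
    ∃ w : ℕ → ℕ, (∀ Q < K, w Q < L) ∧ ∀ f < m, ∃ Q < K, Mem f Q (w Q) := by
  constructor
  · rintro ⟨D, hcard, hD⟩
    have hx : ∀ Q : Fin K, ∃ x ∈ D, x.1 < K * L + K ∧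
        (if x.1 < K * L then x.1 / L else x.1 - K * L) = Q := by
      intro Q
      let v : Fin (K * L + K + m) := ⟨K * L + Q, by omega⟩
      by_cases hv : v ∈ D
      · exact ⟨v, hv, by simp [v], by simp [v]⟩
      · obtain ⟨u, hu, hadj⟩ := hD v hv
        simp only [hittingGraph, SimpleGraph.fromRel_adj, hittingRel, v] at hadj
        have h1 : u.1 < K * L ∧ u.1 / L = Q := by omega
        exact ⟨u, hu, by omega, by rw [if_pos h1.1, h1.2]⟩
    choose x hxD hxlt hxQ using hx
    have hinj : Function.Injective x := fun Q Q' h => by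
      have h1 := hxQ Q
      rw [h, hxQ Q'] at h1
      exact Fin.ext h1.symm
    have himg : Finset.univ.image x = D := by
      refine Finset.eq_of_subset_of_card_le (by simpa [Finset.subset_iff] using hxD) ?_
      rw [Finset.card_image_of_injective _ hinj]
      simpa using hcard
    -- If the chosen vertex is the colour itself, the remainder is an arbitrary value; this is
    -- harmless since a colour dominates no set.
    refine ⟨fun Q => if h : Q < K then (x ⟨Q, h⟩).1 % L else 0, fun Q hQ => ?_, fun f hf => ?_⟩
    · simp only [hQ, dif_pos]
      exact Nat.mod_lt _ hL
    · let v : Fin (K * L + K + m) := ⟨K * L + K + f, by omega⟩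
      have hmem : ∀ u ∈ D, ∃ Q, x Q = u := fun u hu => by
        rw [← himg] at hu
        simpa using hu
      have hv : v ∉ D := fun h => by
        obtain ⟨Q, hQ⟩ := hmem v h
        have := hxlt Q
        rw [hQ] at this
        simp [v] at this
      obtain ⟨u, hu, hadj⟩ := hD v hv
      obtain ⟨Q, rfl⟩ := hmem u hu
      simp only [hittingGraph, SimpleGraph.fromRel_adj, hittingRel, v] at hadj
      have h1 := hxlt Q
      have h2 := hxQ Q
      have h3 : (x Q).1 < K * L ∧ Mem (K * L + K + f - (K * L + K)) ((x Q).1 / L) ((x Q).1 % L) := by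
        rcases hadj.2 with (h | h | h | h) | (h | h | h | h)
        all_goals first | omega | exact ⟨h.1, h.2.2⟩
      rw [if_pos h3.1] at h2
      refine ⟨Q, Q.2, ?_⟩
      simp only [Q.2, dif_pos]
      have h4 := h3.2
      rw [h2, Nat.add_sub_cancel_left] at h4
      exact h4
  · rintro ⟨w, hw, hhit⟩
    have hlt : ∀ Q < K, w Q + L * Q < K * L := fun Q hQ => by
      have := hw Q hQ
      calc w Q + L * Q < L + L * Q := by omega
        _ = (Q + 1) * L := by ring
        _ ≤ K * L := Nat.mul_le_mul_right _ hQ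
    let x : Fin K → Fin (K * L + K + m) := fun Q => ⟨w Q + L * Q, by have := hlt Q Q.2; omega⟩
    have hdiv : ∀ Q : Fin K, (w Q + L * Q) / L = Q := fun Q => by
      rw [Nat.add_mul_div_left _ _ hL, Nat.div_eq_of_lt (hw Q Q.2), zero_add]
    have hmod : ∀ Q : Fin K, (w Q + L * Q) % L = w Q := fun Q => by
      rw [Nat.add_mul_mod_self_left, Nat.mod_eq_of_lt (hw Q Q.2)]
    refine ⟨Finset.univ.image x, Finset.card_image_le.trans (by simp), fun v hv => ?_⟩
    have hne : ∀ Q, v ≠ x Q := fun Q h => hv (by simp [h])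
    suffices ∃ Q, hittingRel K L Mem (x Q) v by
      obtain ⟨Q, hQ⟩ := this
      exact ⟨x Q, by simp, by simp [hittingGraph, hne Q, hQ]⟩
    by_cases h1 : v.1 < K * L
    · have hQ : v.1 / L < K := by rwa [Nat.div_lt_iff_lt_mul hL]
      exact ⟨⟨_, hQ⟩, .inl ⟨hlt _ hQ, h1⟩⟩
    by_cases h2 : v.1 < K * L + K
    · have hQ : v.1 - K * L < K := by omega
      exact ⟨⟨_, hQ⟩, .inr (.inl ⟨hlt _ hQ, by omega, h2, hdiv ⟨_, hQ⟩⟩)⟩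
    · obtain ⟨Q, hQ, hmem⟩ := hhit (v.1 - (K * L + K)) (by omega)
      refine ⟨⟨Q, hQ⟩, .inr (.inr (.inl ⟨hlt _ hQ, by omega, ?_⟩))⟩
      have h1 := hdiv ⟨Q, hQ⟩
      have h2 := hmod ⟨Q, hQ⟩
      simp only [x] at h1 h2 ⊢
      rwa [h1, h2]

end ParamComplexity

namespace ParamComplexity

/-! ### From local constraints to hitting sets -/

/-- The values of `X` at the last `r` digits of `q` (base `m`), as digits in base `A`. -/
def digitMap (X : ℕ → ℕ) (m A : ℕ) : ℕ → ℕ → ℕ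
  | 0, _ => 0
  | r + 1, q => X (q % m) + A * digitMap X m A r (q / m)

/-! ### Tuples of positions and tuples of letters, coded as numbers -/

section digitMap

variable {X : ℕ → ℕ} {m A : ℕ}

theorem digitMap_lt (hm : 0 < m) (hX : ∀ i < m, X i < A) (r q : ℕ) :
    digitMap X m A r q < A ^ r := by
  induction r generalizing q with
  | zero => simp [digitMap]
  | succ r ih =>
    have h1 := hX (q % m) (Nat.mod_lt _ hm)
    have h2 := ih (q / m)
    calc digitMap X m A (r + 1) q < A + A * digitMap X m A r (q / m) := by
          simp only [digitMap]; omega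
      _ = A * (digitMap X m A r (q / m) + 1) := by ring
      _ ≤ A * A ^ r := Nat.mul_le_mul_left _ h2
      _ = A ^ (r + 1) := by ring

theorem digitMap_digit (hm : 0 < m) (hX : ∀ i < m, X i < A) {r a : ℕ} (ha : a < r) (q : ℕ) :
    digitMap X m A r q / A ^ a % A = X (q / m ^ a % m) := by
  induction r generalizing q a with
  | zero => omega
  | succ r ih =>
    have h1 := hX (q % m) (Nat.mod_lt _ hm)
    cases a with
    | zero => simp [digitMap, Nat.mod_eq_of_lt h1]
    | succ a =>
      rw [pow_succ', ← Nat.div_div_eq_div_mul, pow_succ', ← Nat.div_div_eq_div_mul,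
        ← ih (by omega) (q / m), digitMap, Nat.add_mul_div_left _ _ (by omega),
        Nat.div_eq_of_lt h1, zero_add]

theorem eq_digitMap {r w q : ℕ} (hw : w < A ^ r)
    (h : ∀ a < r, w / A ^ a % A = X (q / m ^ a % m)) : w = digitMap X m A r q := by
  induction r generalizing w q with
  | zero => simpa [digitMap] using hw
  | succ r ih =>
    have h0 := h 0 (by omega)
    simp only [pow_zero, Nat.div_one] at h0
    rw [digitMap, ← h0, ← ih (w := w / A), Nat.mod_add_div]
    · exact Nat.div_lt_of_lt_mul (by rwa [← pow_succ'])
    · intro a ha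
      have := h (a + 1) (by omega)
      rwa [pow_succ', ← Nat.div_div_eq_div_mul, pow_succ', ← Nat.div_div_eq_div_mul] at this

theorem digitMap_mod (r q : ℕ) : digitMap X m A r (q % m ^ r) = digitMap X m A r q := by
  induction r generalizing q with
  | zero => rfl
  | succ r ih =>
    simp only [digitMap]
    rw [pow_succ', Nat.mod_mul_right_mod, Nat.mod_mul_right_div_self, ih]

/-- Concatenating two tuples of positions concatenates their tuples of letters. In this way the
certificates for two subgames are glued together and taken apart. -/
theorem digitMap_add (r s q : ℕ) : digitMap X m A (r + s) q =
    digitMap X m A r (q % m ^ r) + A ^ r * digitMap X m A s (q / m ^ r) := by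
  rw [digitMap_mod]
  induction r generalizing q with
  | zero => simp [digitMap]
  | succ r ih =>
    rw [Nat.succ_add, digitMap, digitMap, ih, pow_succ' m, ← Nat.div_div_eq_div_mul]
    ring

theorem digitMap_add_mod (hm : 0 < m) (hX : ∀ i < m, X i < A) (r s q : ℕ) :
    digitMap X m A (r + s) q % A ^ r = digitMap X m A r (q % m ^ r) := by
  rw [digitMap_add, Nat.add_mul_mod_self_left, Nat.mod_eq_of_lt (digitMap_lt hm hX _ _)]

theorem digitMap_add_div (hm : 0 < m) (hX : ∀ i < m, X i < A) (r s q : ℕ) :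
    digitMap X m A (r + s) q / A ^ r = digitMap X m A s (q / m ^ r) := by
  have hA : 0 < A := (Nat.zero_le _).trans_lt (hX 0 hm)
  rw [digitMap_add, Nat.add_mul_div_left _ _ (pow_pos hA _),
    Nat.div_eq_of_lt (digitMap_lt hm hX _ _), zero_add]

end digitMap

/-- The sets to be hit, for colours `q < m ^ r` and values below `A ^ r`: the first `J` of them
come from a relation `R`, the others force the value chosen for a colour `q` to be
`digitMap X m A r q` for some `X`. -/
def localMem (m A r J : ℕ) (R : ℕ → ℕ → ℕ → Prop) (f Q w : ℕ) : Prop :=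
  (f < J ∧ R f Q w) ∨ (J ≤ f ∧
    ((Q = (f - J) % m ^ r ∧ w ≠ (f - J) / m ^ r % A ^ r) ∨
    (Q = (f - J) / m ^ r / A ^ r ∧ ∀ a < r, (f - J) % m ^ r / m ^ a % m = (f - J) / m ^ r / A ^ r →
      (f - J) / m ^ r % A ^ r / A ^ a % A = w % A)))

/-- The number `i < m`, read as a tuple, has lowest digit `i`, so the lowest digit of the value
chosen for the colour `i` can serve as `X i`. The consistency set for `(q, v, i)` is hit by the
colour `q` if its value is not `v`; otherwise the colour `i` must hit it, which says that `v` has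
the letter `X i` wherever `q` has the position `i`. Since `0 < r`, every `i < m` is a colour. -/
theorem localMem_hitting_iff {m A r J : ℕ} {R : ℕ → ℕ → ℕ → Prop} (hm : 0 < m) (hA : 0 < A)
    (hr : 0 < r) :
    (∃ w : ℕ → ℕ, (∀ Q < m ^ r, w Q < A ^ r) ∧
      ∀ f < J + m ^ r * (A ^ r * m), ∃ Q < m ^ r, localMem m A r J R f Q (w Q)) ↔
    ∃ X : ℕ → ℕ, (∀ i < m, X i < A) ∧ ∀ j < J, ∃ q < m ^ r, R j q (digitMap X m A r q) := by
  have hmr : m ≤ m ^ r := Nat.le_self_pow hr.ne' m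
  constructor
  · rintro ⟨w, hw, hhit⟩
    let X : ℕ → ℕ := fun i => w i % A
    have hX : ∀ i < m, X i < A := fun i _ => Nat.mod_lt _ hA
    have hwq : ∀ q < m ^ r, w q = digitMap X m A r q := by
      intro q hq
      refine eq_digitMap (hw q hq) fun a ha => ?_
      set i := q / m ^ a % m with hi
      have him : i < m := Nat.mod_lt _ hm
      have hwq := hw q hq
      -- This codes the triple `(q, w q, i)`: with `v = w q` the first way of hitting is excluded.
      let g := q + m ^ r * (w q + A ^ r * i)
      have e1 : g % m ^ r = q := by
        rw [Nat.add_mul_mod_self_left, Nat.mod_eq_of_lt hq]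
      have e2 : g / m ^ r = w q + A ^ r * i := by
        rw [Nat.add_mul_div_left _ _ (pow_pos hm _), Nat.div_eq_of_lt hq, zero_add]
      have e3 : g / m ^ r % A ^ r = w q := by
        rw [e2, Nat.add_mul_mod_self_left, Nat.mod_eq_of_lt hwq]
      have e4 : g / m ^ r / A ^ r = i := by
        rw [e2, Nat.add_mul_div_left _ _ (pow_pos hA _), Nat.div_eq_of_lt hwq, zero_add]
      have hlt : J + g < J + m ^ r * (A ^ r * m) := by
        have h1 : w q + A ^ r * i < A ^ r * m := by
          calc w q + A ^ r * i < A ^ r + A ^ r * i := by omega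
            _ = A ^ r * (i + 1) := by ring
            _ ≤ _ := Nat.mul_le_mul_left _ him
        have h2 : g < m ^ r * (A ^ r * m) := by
          calc g < m ^ r + m ^ r * (w q + A ^ r * i) := by simp only [g]; omega
            _ = m ^ r * (w q + A ^ r * i + 1) := by ring
            _ ≤ _ := Nat.mul_le_mul_left _ h1
        omega
      obtain ⟨Q, hQ, h | ⟨-, h⟩⟩ := hhit _ hlt
      · omega
      · rw [Nat.add_sub_cancel_left, e1, e3, e4] at h
        rcases h with ⟨rfl, h⟩ | ⟨rfl, h⟩
        · exact absurd rfl h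
        · exact h a ha rfl
    refine ⟨X, hX, fun j hj => ?_⟩
    obtain ⟨Q, hQ, ⟨-, h⟩ | h⟩ := hhit j (by omega)
    · exact ⟨Q, hQ, by rwa [← hwq Q hQ]⟩
    · omega
  · rintro ⟨X, hX, h⟩
    refine ⟨digitMap X m A r, fun Q _ => digitMap_lt hm hX r Q, fun f hf => ?_⟩
    rcases lt_or_ge f J with hfJ | hfJ
    · obtain ⟨q, hq, hR⟩ := h f hfJ
      exact ⟨q, hq, .inl ⟨hfJ, hR⟩⟩
    · set g := f - J with hg
      set q := g % m ^ r with hq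
      set i := g / m ^ r / A ^ r with hi
      have him : i < m := by
        rw [hi, Nat.div_lt_iff_lt_mul (pow_pos hA _), Nat.div_lt_iff_lt_mul (pow_pos hm _)]
        calc g < m ^ r * (A ^ r * m) := by omega
          _ = _ := by ring
      by_cases hv : digitMap X m A r q = g / m ^ r % A ^ r
      · refine ⟨i, by omega, .inr ⟨hfJ, .inr ⟨rfl, fun a ha hai => ?_⟩⟩⟩
        have h1 := digitMap_digit hm hX ha q
        have h2 := digitMap_digit hm hX hr i
        simp only [pow_zero, Nat.div_one, Nat.mod_eq_of_lt him] at h2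
        rw [← hg, ← hv, h1, h2]
        rw [← hg, ← hq, ← hi] at hai
        rw [hai]
      · exact ⟨q, Nat.mod_lt _ (pow_pos hm _), .inr ⟨hfJ, .inl ⟨rfl, hv⟩⟩⟩

end ParamComplexity

namespace ParamComplexity

/-! ### The evaluation game on a circuit -/

/-- The data of a circuit on natural numbers: the two bits of the kind of a node and the wires. -/
structure GateTable where
  size : ℕ
  bit₁ : ℕ → Prop
  bit₂ : ℕ → Prop
  wire : ℕ → ℕ → Prop

namespace GateTable

variable (G : GateTable)

def IsInput (i : ℕ) : Prop := ¬ G.bit₁ i ∧ ¬ G.bit₂ i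
def IsNot (i : ℕ) : Prop := ¬ G.bit₁ i ∧ G.bit₂ i
def IsAnd (i : ℕ) : Prop := G.bit₁ i ∧ ¬ G.bit₂ i
def IsOr (i : ℕ) : Prop := G.bit₁ i ∧ G.bit₂ i

/-- The claim that gate `i` has the value `b` is a claim about all (rather than some) of the nodes
fed into it. -/
def Univ (b : Prop) (i : ℕ) : Prop := (b ∧ ¬ G.IsOr i) ∨ (¬ b ∧ ¬ G.IsAnd i)

/-- The value claimed for the nodes fed into `i` if `b` is claimed for `i`. -/
def Claim (b : Prop) (i : ℕ) : Prop := b ↔ ¬ G.IsNot i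

def First (j i : ℕ) : Prop := ∀ j' < j, ¬ G.wire j' i

def Small (i : ℕ) : Prop := ∃ l < G.size, ∃ h < G.size, ∀ j < G.size, G.wire j i → j = l ∨ j = h

/-- The number of codes of strategies of depth `e`: a node, and two strategies of smaller depth. -/
def codes : ℕ → ℕ
  | 0 => 1
  | e + 1 => G.size * (codes e * codes e)

/-- One step in the game about the claim that node `i` has value `b`. At a small gate both
subgames are looked at, with the strategies for the first and the second node fed into it. At a large
gate, the refuter moves to `x`, and the prover to `y` if there was no large gate before (`c = 0`) or
to any node otherwise. -/
def Step (c : ℕ) (b : Prop) (y x : ℕ) (W₁ W₂ : ℕ → Prop → ℕ → Prop) (i : ℕ) : Prop :=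
  (G.IsInput i ∧ W₁ c b i) ∨
  (¬ G.IsInput i ∧ (G.Small i ∧ (G.Univ b i ∧ ∀ j < G.size, G.wire j i →
    (G.First j i → W₁ c (G.Claim b i) j) ∧ (¬ G.First j i → W₂ c (G.Claim b i) j)))) ∨
  (¬ G.IsInput i ∧ (G.Small i ∧ (¬ G.Univ b i ∧ ∃ j < G.size, G.wire j i ∧
    ((G.First j i ∧ W₁ c (G.Claim b i) j) ∨ (¬ G.First j i ∧ W₂ c (G.Claim b i) j))))) ∨
  (¬ G.IsInput i ∧ (¬ G.Small i ∧ (G.Univ b i ∧ (G.wire x i → W₁ (c + 1) (G.Claim b i) x)))) ∨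
  (¬ G.IsInput i ∧ (¬ G.Small i ∧ (¬ G.Univ b i ∧
    (c = 0 ∧ (G.wire y i ∧ W₁ (c + 1) (G.Claim b i) y))))) ∨
  (¬ G.IsInput i ∧ (¬ G.Small i ∧ (¬ G.Univ b i ∧
    (c ≠ 0 ∧ ∃ j < G.size, G.wire j i ∧ W₁ (c + 1) (G.Claim b i) j))))

/-- The claim that node `i` has value `b` wins in the game of depth `e` when the prover plays the
strategy with code `Y`, the refuter plays the strategy with code `J`, and `leaf` decides about the
inputs, where it is given two digits of `q` (base `m`) and of `w` (base `A`). -/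
def Win (m A : ℕ) (leaf : Prop → ℕ → ℕ → ℕ → Prop) :
    ℕ → ℕ → Prop → ℕ → ℕ → ℕ → ℕ → ℕ → Prop
  | 0, _, b, _, _, q, w, i => G.IsInput i ∧ leaf b q w i
  | e + 1, c, b, Y, J, q, w, i => G.Step c b (Y % G.size) (J % G.size)
      (fun c b i => Win m A leaf e c b (Y / G.size % G.codes e) (J / G.size % G.codes e)
        (q % m ^ 2 ^ (e + 1)) (w % A ^ 2 ^ (e + 1)) i)
      (fun c b i => Win m A leaf e c b (Y / G.size / G.codes e) (J / G.size / G.codes e)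
        (q / m ^ 2 ^ (e + 1)) (w / A ^ 2 ^ (e + 1)) i) i

variable {G}

theorem step_input {i : ℕ} (hi : G.IsInput i) (c : ℕ) (b : Prop) (y x : ℕ)
    (W₁ W₂ : ℕ → Prop → ℕ → Prop) : G.Step c b y x W₁ W₂ i ↔ W₁ c b i := by
  simp [Step, hi]

open Classical in
theorem step_large {i : ℕ} (hi : ¬ G.IsInput i) (hs : ¬ G.Small i) (c : ℕ) (b : Prop) (y x : ℕ)
    (W₁ W₂ : ℕ → Prop → ℕ → Prop) : G.Step c b y x W₁ W₂ i ↔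
      if G.Univ b i then (G.wire x i → W₁ (c + 1) (G.Claim b i) x)
      else if c = 0 then G.wire y i ∧ W₁ (c + 1) (G.Claim b i) y
      else ∃ j < G.size, G.wire j i ∧ W₁ (c + 1) (G.Claim b i) j := by
  by_cases hu : G.Univ b i <;> by_cases hc : c = 0 <;> simp [Step, hi, hs, hu, hc]

-- A small gate is fed by a first node and at most one other, so `W₁` and `W₂` are each consulted at
-- one fixed node, whatever the moves and the claim. Without `hfed` there might be no first node.
open Classical in
theorem step_small {i : ℕ} (hi : ¬ G.IsInput i) (hs : G.Small i)
    (hfed : ∃ j < G.size, G.wire j i) :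
    (∃ j₁ < G.size, G.wire j₁ i ∧ ∀ c b y x W₁ W₂,
      G.Step c b y x W₁ W₂ i ↔ W₁ c (G.Claim b i) j₁) ∨
    ∃ j₁ < G.size, G.wire j₁ i ∧ ∃ j₂ < G.size, G.wire j₂ i ∧ ∀ c b y x W₁ W₂,
      G.Step c b y x W₁ W₂ i ↔
        if G.Univ b i then W₁ c (G.Claim b i) j₁ ∧ W₂ c (G.Claim b i) j₂
        else W₁ c (G.Claim b i) j₁ ∨ W₂ c (G.Claim b i) j₂ := by
  obtain ⟨j₁, hj₁, hw₁, hf₁⟩ : ∃ j₁ < G.size, G.wire j₁ i ∧ G.First j₁ i := by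
    have hex : ∃ j, j < G.size ∧ G.wire j i := hfed
    refine ⟨Nat.find hex, (Nat.find_spec hex).1, (Nat.find_spec hex).2, fun j' hj' hw => ?_⟩
    exact Nat.find_min hex hj' ⟨hj'.trans (Nat.find_spec hex).1, hw⟩
  have huniq : ∀ j, G.wire j i → G.First j i → j = j₁ := fun j hw hf => by
    rcases lt_trichotomy j j₁ with h | h | h
    · exact absurd hw (hf₁ j h)
    · exact h
    · exact absurd hw₁ (hf j₁ h)
  by_cases h2 : ∃ j₂ < G.size, G.wire j₂ i ∧ ¬ G.First j₂ i
  · obtain ⟨j₂, hj₂, hw₂, hf₂⟩ := h2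
    have huniq₂ : ∀ j < G.size, G.wire j i → ¬ G.First j i → j = j₂ := fun j hj hw hf => by
      obtain ⟨l, -, h, -, hlh⟩ := hs
      have h1 := hlh j₁ hj₁ hw₁
      have h2 := hlh j₂ hj₂ hw₂
      have h3 := hlh j hj hw
      have h4 : j₁ ≠ j₂ := fun e => hf₂ (e ▸ hf₁)
      have h5 : j₁ ≠ j := fun e => hf (e ▸ hf₁)
      omega
    refine .inr ⟨j₁, hj₁, hw₁, j₂, hj₂, hw₂, fun c b y x W₁ W₂ => ?_⟩
    by_cases hu : G.Univ b i
    · simp only [Step, hi, hs, hu, false_and, not_false_eq_true, not_true_eq_false, true_and,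
        or_false, false_or, if_true]
      refine ⟨fun h => ⟨(h j₁ hj₁ hw₁).1 hf₁, (h j₂ hj₂ hw₂).2 hf₂⟩, fun h j hj hw =>
        ⟨fun hf => huniq j hw hf ▸ h.1, fun hf => huniq₂ j hj hw hf ▸ h.2⟩⟩
    · simp only [Step, hi, hs, hu, false_and, not_false_eq_true, not_true_eq_false, true_and,
        or_false, false_or, if_false]
      constructor
      · rintro ⟨j, hj, hw, ⟨hf, h⟩ | ⟨hf, h⟩⟩
        · exact .inl (huniq j hw hf ▸ h)
        · exact .inr (huniq₂ j hj hw hf ▸ h)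
      · rintro (h | h)
        · exact ⟨j₁, hj₁, hw₁, .inl ⟨hf₁, h⟩⟩
        · exact ⟨j₂, hj₂, hw₂, .inr ⟨hf₂, h⟩⟩
  · push Not at h2
    refine .inl ⟨j₁, hj₁, hw₁, fun c b y x W₁ W₂ => ?_⟩
    by_cases hu : G.Univ b i
    · simp only [Step, hi, hs, hu, false_and, not_false_eq_true, not_true_eq_false, true_and,
        or_false, false_or]
      refine ⟨fun h => (h j₁ hj₁ hw₁).1 hf₁, fun h j hj hw =>
        ⟨fun hf => huniq j hw hf ▸ h, fun hf => absurd (h2 j hj hw) hf⟩⟩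
    · simp only [Step, hi, hs, hu, false_and, not_false_eq_true, not_true_eq_false, true_and,
        or_false, false_or]
      constructor
      · rintro ⟨j, hj, hw, ⟨hf, h⟩ | ⟨hf, h⟩⟩
        · exact huniq j hw hf ▸ h
        · exact absurd (h2 j hj hw) hf
      · exact fun h => ⟨j₁, hj₁, hw₁, .inl ⟨hf₁, h⟩⟩

/-- Every gate is fed by some node. -/
def Fed (G : GateTable) : Prop := ∀ i < G.size, ¬ G.IsInput i → ∃ j < G.size, G.wire j i

/-- A step is monotone in `W₁` and `W₂` and needs each of them at no more than one node, so
existential quantifiers can be pulled out; `0` serves as certificate for a subgame that is not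
needed. A conjunction over many nodes would need many certificates, which is why a universal large
gate follows the move `x` instead of a quantifier. -/
theorem step_exists_iff (hG : G.Fed) {B : ℕ} (hB : 0 < B) {W₁ W₂ : ℕ → Prop → ℕ → Prop}
    {V₁ V₂ : ℕ → ℕ → Prop → ℕ → Prop}
    (h₁ : ∀ c b, ∀ i < G.size, W₁ c b i ↔ ∃ q < B, V₁ q c b i)
    (h₂ : ∀ c b, ∀ i < G.size, W₂ c b i ↔ ∃ q < B, V₂ q c b i) {y x i : ℕ} (hy : y < G.size)
    (hx : x < G.size) (hi : i < G.size) (c : ℕ) (b : Prop) :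
    G.Step c b y x W₁ W₂ i ↔ ∃ q₁ < B, ∃ q₂ < B, G.Step c b y x (V₁ q₁) (V₂ q₂) i := by
  by_cases hin : G.IsInput i
  · simp only [step_input hin, h₁ c b i hi]
    exact ⟨fun ⟨q, hq, h⟩ => ⟨q, hq, 0, hB, h⟩, fun ⟨q, hq, _, _, h⟩ => ⟨q, hq, h⟩⟩
  by_cases hs : G.Small i
  · rcases step_small hin hs (hG i hi hin) with ⟨j₁, hj₁, -, h⟩ | ⟨j₁, hj₁, -, j₂, hj₂, -, h⟩
    · simp only [h, h₁ _ _ j₁ hj₁]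
      exact ⟨fun ⟨q, hq, h⟩ => ⟨q, hq, 0, hB, h⟩, fun ⟨q, hq, _, _, h⟩ => ⟨q, hq, h⟩⟩
    · simp only [h, h₁ _ _ j₁ hj₁, h₂ _ _ j₂ hj₂]
      split_ifs
      · exact ⟨fun ⟨⟨q, hq, h⟩, q', hq', h'⟩ => ⟨q, hq, q', hq', h, h'⟩,
          fun ⟨q, hq, q', hq', h, h'⟩ => ⟨⟨q, hq, h⟩, q', hq', h'⟩⟩
      · constructor
        · rintro (⟨q, hq, h⟩ | ⟨q, hq, h⟩)
          · exact ⟨q, hq, 0, hB, .inl h⟩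
          · exact ⟨0, hB, q, hq, .inr h⟩
        · rintro ⟨q, hq, q', hq', h | h⟩
          · exact .inl ⟨q, hq, h⟩
          · exact .inr ⟨q', hq', h⟩
  · simp only [step_large hin hs]
    split_ifs
    · rw [h₁ _ _ x hx]
      constructor
      · intro h
        by_cases hw : G.wire x i
        · obtain ⟨q, hq, h⟩ := h hw
          exact ⟨q, hq, 0, hB, fun _ => h⟩
        · exact ⟨0, hB, 0, hB, fun h => absurd h hw⟩
      · exact fun ⟨q, hq, _, _, h⟩ hw => ⟨q, hq, h hw⟩
    · rw [h₁ _ _ y hy]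
      exact ⟨fun ⟨hw, q, hq, h⟩ => ⟨q, hq, 0, hB, hw, h⟩,
        fun ⟨q, hq, _, _, hw, h⟩ => ⟨hw, q, hq, h⟩⟩
    · constructor
      · rintro ⟨j, hj, hw, h⟩
        rw [h₁ _ _ j hj] at h
        obtain ⟨q, hq, h⟩ := h
        exact ⟨q, hq, 0, hB, j, hj, hw, h⟩
      · rintro ⟨q, hq, _, _, j, hj, hw, h⟩
        exact ⟨j, hj, hw, (h₁ _ _ j hj).2 ⟨q, hq, h⟩⟩

theorem exists_lt_mul {B C : ℕ} {P : ℕ → ℕ → Prop} :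
    (∃ q < B * C, P (q % B) (q / B)) ↔ ∃ q₁ < B, ∃ q₂ < C, P q₁ q₂ := by
  constructor
  · rintro ⟨q, hq, h⟩
    have hB : 0 < B := Nat.pos_of_ne_zero (by rintro rfl; simp at hq)
    exact ⟨_, Nat.mod_lt _ hB, _, Nat.div_lt_of_lt_mul hq, h⟩
  · rintro ⟨q₁, h₁, q₂, h₂, h⟩
    refine ⟨q₁ + B * q₂, ?_, ?_⟩
    · calc q₁ + B * q₂ < B + B * q₂ := by omega
        _ = B * (q₂ + 1) := by ring
        _ ≤ _ := Nat.mul_le_mul_left _ h₂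
    · rwa [Nat.add_mul_mod_self_left, Nat.mod_eq_of_lt h₁, Nat.add_mul_div_left _ _ (by omega),
        Nat.div_eq_of_lt h₁, zero_add]

theorem forall_lt_mul {B C : ℕ} {P : ℕ → ℕ → Prop} :
    (∀ q < B * C, P (q % B) (q / B)) ↔ ∀ q₁ < B, ∀ q₂ < C, P q₁ q₂ := by
  have := exists_lt_mul (B := B) (C := C) (P := fun a b => ¬ P a b)
  rw [← not_iff_not]
  push Not
  exact this

theorem exists_lt_codes {N B : ℕ} {P : ℕ → ℕ → ℕ → Prop} :
    (∃ Y < N * (B * B), P (Y % N) (Y / N % B) (Y / N / B)) ↔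
      ∃ y < N, ∃ Y₁ < B, ∃ Y₂ < B, P y Y₁ Y₂ := by
  rw [exists_lt_mul (P := fun y Y => P y (Y % B) (Y / B))]
  exact exists_congr fun y => and_congr_right fun _ => exists_lt_mul (P := P y)

theorem forall_lt_codes {N B : ℕ} {P : ℕ → ℕ → ℕ → Prop} :
    (∀ Y < N * (B * B), P (Y % N) (Y / N % B) (Y / N / B)) ↔
      ∀ y < N, ∀ Y₁ < B, ∀ Y₂ < B, P y Y₁ Y₂ := by
  rw [forall_lt_mul (P := fun y Y => P y (Y % B) (Y / B))]
  exact forall₂_congr fun y _ => forall_lt_mul (P := P y)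

/-- Local certificates for the values of the inputs give local certificates for the game. -/
theorem win_certificate (hG : G.Fed) (hN : 0 < G.size) {m A : ℕ} {X : ℕ → ℕ} (hm : 0 < m)
    (hX : ∀ i < m, X i < A) {v : ℕ → Prop} {leaf : Prop → ℕ → ℕ → ℕ → Prop}
    (hleaf : ∀ b, ∀ i < G.size, G.IsInput i →
      ((v i ↔ b) ↔ ∃ q < m ^ 2, leaf b q (digitMap X m A 2 q) i))
    (e c : ℕ) (b : Prop) (Y J q' w' : ℕ) {i : ℕ} (hi : i < G.size) :
    G.Win m A (fun b _ _ i => v i ↔ b) e c b Y J q' w' i ↔ ∃ q < m ^ 2 ^ (e + 1),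
      G.Win m A leaf e c b Y J q (digitMap X m A (2 ^ (e + 1)) q) i := by
  induction e generalizing c b Y J q' w' i with
  | zero =>
    simp only [Win]
    by_cases hin : G.IsInput i
    · simpa [hin] using hleaf b i hi hin
    · simp [hin]
  | succ e ih =>
    -- A certificate of depth `e + 1` is a pair of certificates of depth `e`.
    have hpow : 2 ^ (e + 1 + 1) = 2 ^ (e + 1) + 2 ^ (e + 1) := by ring
    simp only [Win]
    rw [hpow, pow_add m (2 ^ (e + 1)) (2 ^ (e + 1))]
    simp only [digitMap_add_mod hm hX, digitMap_add_div hm hX]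
    rw [exists_lt_mul (P := fun q₁ q₂ => G.Step c b (Y % G.size) (J % G.size)
      (fun c b i => G.Win m A leaf e c b (Y / G.size % G.codes e) (J / G.size % G.codes e)
        q₁ (digitMap X m A (2 ^ (e + 1)) q₁) i)
      (fun c b i => G.Win m A leaf e c b (Y / G.size / G.codes e) (J / G.size / G.codes e)
        q₂ (digitMap X m A (2 ^ (e + 1)) q₂) i) i)]
    exact step_exists_iff hG (pow_pos hm _) (fun c b i hi => ih c b _ _ _ _ hi)
      (fun c b i hi => ih c b _ _ _ _ hi) (Nat.mod_lt _ hN) (Nat.mod_lt _ hN) hi c b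

/-- `i` has depth at most `e` and weft at most `w`. -/
def DepthWeft (G : GateTable) : ℕ → ℕ → ℕ → Prop
  | 0, _, i => G.IsInput i
  | e + 1, w, i => G.IsInput i ∨
      (¬ G.IsInput i ∧ G.Small i ∧ ∀ j < G.size, G.wire j i → DepthWeft G e w j) ∨
      (¬ G.IsInput i ∧ ¬ G.Small i ∧ 0 < w ∧
        ∀ j < G.size, G.wire j i → DepthWeft G e (w - 1) j)

theorem depthWeft_of_isInput {i : ℕ} (hi : G.IsInput i) (e w : ℕ) : G.DepthWeft e w i := by
  cases e
  · exact hi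
  · exact .inl hi

open Classical in
/-- `v` is the vector of the values of the nodes. -/
def Evaluates (G : GateTable) (v : ℕ → Prop) : Prop :=
  ∀ i < G.size, ¬ G.IsInput i → ∀ b, (v i ↔ b) ↔
    if G.Univ b i then ∀ j < G.size, G.wire j i → (v j ↔ G.Claim b i)
    else ∃ j < G.size, G.wire j i ∧ (v j ↔ G.Claim b i)

/-- This writes the truth of the claim as a step of the game, so that `step_small` unfolds both
sides of the equivalences below in the same way. -/
theorem Evaluates.step {v : ℕ → Prop} (hv : G.Evaluates v) {i : ℕ} (hi : i < G.size)
    (hin : ¬ G.IsInput i) (hs : G.Small i) (b : Prop) (c y x : ℕ) :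
    G.Step c b y x (fun _ b j => v j ↔ b) (fun _ b j => v j ↔ b) i ↔ (v i ↔ b) := by
  rw [hv i hi hin b]
  by_cases hu : G.Univ b i
  · simp only [Step, hin, hs, hu, false_and, not_false_eq_true, not_true_eq_false, true_and,
      or_false, false_or, if_true]
    exact forall₃_congr fun j _ _ => by tauto
  · simp only [Step, hin, hs, hu, false_and, not_false_eq_true, not_true_eq_false, true_and,
      or_false, false_or, if_false]
    exact exists_congr fun j => by tauto

theorem codes_pos (hN : 0 < G.size) (e : ℕ) : 0 < G.codes e := by
  induction e with
  | zero => exact Nat.one_pos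
  | succ e ih => exact Nat.mul_pos hN (Nat.mul_pos ih ih)

/-! ### The game decides the value of a node of weft at most two -/

section weft

variable (hG : G.Fed) (hN : 0 < G.size) {m A : ℕ} {v : ℕ → Prop} (hv : G.Evaluates v)
include hG hv

/-- Moves matter at large gates only; where there are none, the game is plain evaluation. -/
theorem win_iff_of_weft_zero {e i : ℕ} (hi : i < G.size) (h : G.DepthWeft e 0 i) (c : ℕ)
    (b : Prop) (Y J q w : ℕ) : G.Win m A (fun b _ _ i => v i ↔ b) e c b Y J q w i ↔ (v i ↔ b) := by
  induction e generalizing i c b Y J q w with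
  | zero => simp only [Win, show G.IsInput i from h, true_and]
  | succ e ih =>
    simp only [Win]
    rcases h with h | ⟨hin, hs, h⟩ | ⟨-, -, h, -⟩
    · rw [step_input h, ih hi (depthWeft_of_isInput h _ _)]
    · rw [← hv.step hi hin hs b 0 0 0]
      rcases step_small hin hs (hG i hi hin) with ⟨j₁, hj₁, hw₁, hst⟩ |
        ⟨j₁, hj₁, hw₁, j₂, hj₂, hw₂, hst⟩
      · rw [hst, hst, ih hj₁ (h j₁ hj₁ hw₁)]
      · rw [hst, hst, ih hj₁ (h j₁ hj₁ hw₁), ih hj₂ (h j₂ hj₂ hw₂)]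
    · omega

include hN

/-- Because `c ≠ 0`, the prover's move at an existential large gate is a quantifier inside the step,
so `Y` is irrelevant. At a universal large gate the quantifier over `J` supplies all moves `x`, and
the nodes fed into it have weft zero. -/
theorem win_iff_of_weft_one {e i : ℕ} (hi : i < G.size) (h : G.DepthWeft e 1 i) {c : ℕ}
    (hc : c ≠ 0) (b : Prop) (Y q w : ℕ) :
    (∀ J < G.codes e, G.Win m A (fun b _ _ i => v i ↔ b) e c b Y J q w i) ↔ (v i ↔ b) := by
  induction e generalizing i c b Y q w with
  | zero =>
    simp only [Win, show G.IsInput i from h, true_and, codes]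
    exact ⟨fun h => h 0 Nat.one_pos, fun h _ _ => h⟩
  | succ e ih =>
    have hpos := G.codes_pos hN e
    simp only [Win, codes]
    rw [forall_lt_codes (P := fun x J₁ J₂ => G.Step c b (Y % G.size) x
      (fun c b i => G.Win m A (fun b _ _ i => v i ↔ b) e c b (Y / G.size % G.codes e) J₁
        (q % m ^ 2 ^ (e + 1)) (w % A ^ 2 ^ (e + 1)) i)
      (fun c b i => G.Win m A (fun b _ _ i => v i ↔ b) e c b (Y / G.size / G.codes e) J₂
        (q / m ^ 2 ^ (e + 1)) (w / A ^ 2 ^ (e + 1)) i) i)]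
    rcases h with h | ⟨hin, hs, h⟩ | ⟨hin, hs, -, h⟩
    · simp only [step_input h]
      rw [← ih hi (depthWeft_of_isInput h _ _) hc b (Y / G.size % G.codes e)
        (q % m ^ 2 ^ (e + 1)) (w % A ^ 2 ^ (e + 1))]
      exact ⟨fun h J hJ => h 0 hN J hJ 0 hpos, fun h _ _ J hJ _ _ => h J hJ⟩
    · rw [← hv.step hi hin hs b 0 0 0]
      rcases step_small hin hs (hG i hi hin) with ⟨j₁, hj₁, hw₁, hst⟩ |
        ⟨j₁, hj₁, hw₁, j₂, hj₂, hw₂, hst⟩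
      · simp only [hst]
        rw [← ih hj₁ (h j₁ hj₁ hw₁) hc _ (Y / G.size % G.codes e)
          (q % m ^ 2 ^ (e + 1)) (w % A ^ 2 ^ (e + 1))]
        exact ⟨fun h J hJ => h 0 hN J hJ 0 hpos, fun h _ _ J hJ _ _ => h J hJ⟩
      · simp only [hst]
        rw [← ih hj₁ (h j₁ hj₁ hw₁) hc _ (Y / G.size % G.codes e)
          (q % m ^ 2 ^ (e + 1)) (w % A ^ 2 ^ (e + 1)),
          ← ih hj₂ (h j₂ hj₂ hw₂) hc _ (Y / G.size / G.codes e)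
          (q / m ^ 2 ^ (e + 1)) (w / A ^ 2 ^ (e + 1))]
        split_ifs
        · exact ⟨fun h => ⟨fun J hJ => (h 0 hN J hJ 0 hpos).1, fun J hJ => (h 0 hN 0 hpos J hJ).2⟩,
            fun h _ _ J hJ J' hJ' => ⟨h.1 J hJ, h.2 J' hJ'⟩⟩
        · constructor
          · intro h
            -- The two subgames use separate parts of `J`, so two refutations would combine into one
            -- that refutes the disjunction.
            by_contra hcon
            push Not at hcon
            obtain ⟨⟨J, hJ, h1⟩, J', hJ', h2⟩ := hcon
            exact (h 0 hN J hJ J' hJ').elim h1 h2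
          · exact fun h _ _ J hJ J' hJ' => h.imp (fun h => h J hJ) fun h => h J' hJ'
    · simp only [step_large hin hs, hc, if_false]
      rw [hv i hi hin b]
      split_ifs
      · constructor
        · intro hh j hj hw
          exact (win_iff_of_weft_zero hG hv hj (h j hj hw) _ _ _ _ _ _).1
            (hh j hj 0 hpos 0 hpos hw)
        · intro hh j hj J hJ _ _ hw
          exact (win_iff_of_weft_zero hG hv hj (h j hj hw) _ _ _ _ _ _).2 (hh j hj hw)
      · constructor
        · intro hh
          obtain ⟨j, hj, hw, hj'⟩ := hh 0 hN 0 hpos 0 hpos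
          exact ⟨j, hj, hw, (win_iff_of_weft_zero hG hv hj (h j hj hw) _ _ _ _ _ _).1 hj'⟩
        · rintro ⟨j, hj, hw, hj'⟩ _ _ J hJ _ _
          exact ⟨j, hj, hw, (win_iff_of_weft_zero hG hv hj (h j hj hw) _ _ _ _ _ _).2 hj'⟩

/-- Up to the first large gate on a path, small gates split both strategies into independent parts,
so the quantifiers distribute over conjunctions and disjunctions. At that gate `Y` or `J` supplies
the move, and what remains has weft one, where `Y` no longer matters. -/
theorem win_iff_of_weft_two {e i : ℕ} (hi : i < G.size) (h : G.DepthWeft e 2 i)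
    (b : Prop) (q w : ℕ) :
    (∃ Y < G.codes e, ∀ J < G.codes e, G.Win m A (fun b _ _ i => v i ↔ b) e 0 b Y J q w i) ↔
      (v i ↔ b) := by
  induction e generalizing i b q w with
  | zero =>
    simp only [Win, show G.IsInput i from h, true_and, codes]
    exact ⟨fun ⟨_, _, h⟩ => h 0 Nat.one_pos, fun h => ⟨0, Nat.one_pos, fun _ _ => h⟩⟩
  | succ e ih =>
    have hpos := G.codes_pos hN e
    simp only [Win, codes]
    have hJ (Y : ℕ) := forall_lt_codes (N := G.size) (B := G.codes e)
      (P := fun x J₁ J₂ => G.Step 0 b (Y % G.size) x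
      (fun c b i => G.Win m A (fun b _ _ i => v i ↔ b) e c b (Y / G.size % G.codes e) J₁
        (q % m ^ 2 ^ (e + 1)) (w % A ^ 2 ^ (e + 1)) i)
      (fun c b i => G.Win m A (fun b _ _ i => v i ↔ b) e c b (Y / G.size / G.codes e) J₂
        (q / m ^ 2 ^ (e + 1)) (w / A ^ 2 ^ (e + 1)) i) i)
    simp only [hJ]
    rw [exists_lt_codes (P := fun y Y₁ Y₂ => ∀ x < G.size, ∀ J₁ < G.codes e, ∀ J₂ < G.codes e,
      G.Step 0 b y x
      (fun c b i => G.Win m A (fun b _ _ i => v i ↔ b) e c b Y₁ J₁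
        (q % m ^ 2 ^ (e + 1)) (w % A ^ 2 ^ (e + 1)) i)
      (fun c b i => G.Win m A (fun b _ _ i => v i ↔ b) e c b Y₂ J₂
        (q / m ^ 2 ^ (e + 1)) (w / A ^ 2 ^ (e + 1)) i) i)]
    rcases h with h | ⟨hin, hs, h⟩ | ⟨hin, hs, -, h⟩
    · simp only [step_input h]
      rw [← ih hi (depthWeft_of_isInput h _ _) b (q % m ^ 2 ^ (e + 1)) (w % A ^ 2 ^ (e + 1))]
      exact ⟨fun ⟨_, _, Y, hY, _, _, h⟩ => ⟨Y, hY, fun J hJ => h 0 hN J hJ 0 hpos⟩,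
        fun ⟨Y, hY, h⟩ => ⟨0, hN, Y, hY, 0, hpos, fun _ _ J hJ _ _ => h J hJ⟩⟩
    · rw [← hv.step hi hin hs b 0 0 0]
      rcases step_small hin hs (hG i hi hin) with ⟨j₁, hj₁, hw₁, hst⟩ |
        ⟨j₁, hj₁, hw₁, j₂, hj₂, hw₂, hst⟩
      · simp only [hst]
        rw [← ih hj₁ (h j₁ hj₁ hw₁) _ (q % m ^ 2 ^ (e + 1)) (w % A ^ 2 ^ (e + 1))]
        exact ⟨fun ⟨_, _, Y, hY, _, _, h⟩ => ⟨Y, hY, fun J hJ => h 0 hN J hJ 0 hpos⟩,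
          fun ⟨Y, hY, h⟩ => ⟨0, hN, Y, hY, 0, hpos, fun _ _ J hJ _ _ => h J hJ⟩⟩
      · simp only [hst]
        rw [← ih hj₁ (h j₁ hj₁ hw₁) _ (q % m ^ 2 ^ (e + 1)) (w % A ^ 2 ^ (e + 1)),
          ← ih hj₂ (h j₂ hj₂ hw₂) _ (q / m ^ 2 ^ (e + 1)) (w / A ^ 2 ^ (e + 1))]
        split_ifs
        · constructor
          · rintro ⟨_, _, Y, hY, Y', hY', h⟩
            exact ⟨⟨Y, hY, fun J hJ => (h 0 hN J hJ 0 hpos).1⟩,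
              Y', hY', fun J hJ => (h 0 hN 0 hpos J hJ).2⟩
          · rintro ⟨⟨Y, hY, h⟩, Y', hY', h'⟩
            exact ⟨0, hN, Y, hY, Y', hY', fun _ _ J hJ J' hJ' => ⟨h J hJ, h' J' hJ'⟩⟩
        · constructor
          · rintro ⟨_, _, Y, hY, Y', hY', h⟩
            by_contra hcon
            push Not at hcon
            obtain ⟨J, hJ, h1⟩ := hcon.1 Y hY
            obtain ⟨J', hJ', h2⟩ := hcon.2 Y' hY'
            exact (h 0 hN J hJ J' hJ').elim h1 h2
          · rintro (⟨Y, hY, h⟩ | ⟨Y, hY, h⟩)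
            · exact ⟨0, hN, Y, hY, 0, hpos, fun _ _ J hJ _ _ => .inl (h J hJ)⟩
            · exact ⟨0, hN, 0, hpos, Y, hY, fun _ _ _ _ J hJ => .inr (h J hJ)⟩
    · simp only [step_large hin hs, if_true]
      rw [hv i hi hin b]
      split_ifs
      · constructor
        · rintro ⟨_, _, Y, _, _, _, hh⟩ j hj hw
          exact (win_iff_of_weft_one hG hN hv hj (h j hj hw) one_ne_zero _ Y _ _).1
            fun J hJ => hh j hj J hJ 0 hpos hw
        · intro hh
          refine ⟨0, hN, 0, hpos, 0, hpos, fun j hj J hJ _ _ hw => ?_⟩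
          exact (win_iff_of_weft_one hG hN hv hj (h j hj hw) one_ne_zero _ 0 _ _).2 (hh j hj hw) J hJ
      · constructor
        · rintro ⟨j, hj, Y, _, _, _, hh⟩
          have hw := (hh 0 hN 0 hpos 0 hpos).1
          exact ⟨j, hj, hw, (win_iff_of_weft_one hG hN hv hj (h j hj hw) one_ne_zero _ Y _ _).1
            fun J hJ => (hh 0 hN J hJ 0 hpos).2⟩
        · rintro ⟨j, hj, hw, hh⟩
          refine ⟨j, hj, 0, hpos, 0, hpos, fun _ _ J hJ _ _ => ⟨hw, ?_⟩⟩
          exact (win_iff_of_weft_one hG hN hv hj (h j hj hw) one_ne_zero _ 0 _ _).2 hh J hJ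

end weft

end GateTable

end ParamComplexity

namespace ParamComplexity

/-! ### From circuits of weft two to local constraints -/

namespace Circuit

variable (C : Circuit)

/-- The circuit as a table on natural numbers. -/
def table : GateTable where
  size := C.size
  bit₁ i := ∃ h : i < C.size, (C.kind ⟨i, h⟩).bits.1 = true
  bit₂ i := ∃ h : i < C.size, (C.kind ⟨i, h⟩).bits.2 = true
  wire j i := ∃ (hj : j < C.size) (hi : i < C.size), C.wire ⟨j, hj⟩ ⟨i, hi⟩ = true

variable {C}

theorem size_pos : 0 < C.size := (Nat.zero_le _).trans_lt C.out.2

theorem table_isInput_iff (i : Fin C.size) : C.table.IsInput i ↔ C.kind i = .input := by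
  simp only [GateTable.IsInput, table, i.2, exists_true_left]
  cases C.kind i <;> simp [NodeKind.bits]

theorem table_isNot_iff (i : Fin C.size) : C.table.IsNot i ↔ C.kind i = .not := by
  simp only [GateTable.IsNot, table, i.2, exists_true_left]
  cases C.kind i <;> simp [NodeKind.bits]

theorem table_isAnd_iff (i : Fin C.size) : C.table.IsAnd i ↔ C.kind i = .and := by
  simp only [GateTable.IsAnd, table, i.2, exists_true_left]
  cases C.kind i <;> simp [NodeKind.bits]

theorem table_isOr_iff (i : Fin C.size) : C.table.IsOr i ↔ C.kind i = .or := by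
  simp only [GateTable.IsOr, table, i.2, exists_true_left]
  cases C.kind i <;> simp [NodeKind.bits]

theorem table_wire_iff (j i : Fin C.size) : C.table.wire j i ↔ C.wire j i = true := by
  simp [table]

theorem table_fed : C.table.Fed := by
  intro i hi hin
  obtain ⟨j, hj⟩ := C.gate_fed ⟨i, hi⟩ fun h => hin ((table_isInput_iff ⟨i, hi⟩).2 h)
  exact ⟨j, j.2, (table_wire_iff j ⟨i, hi⟩).2 hj⟩

/-- Claiming falsity dualizes the quantifier at an `and` or `or` gate. A `not` gate is treated as
universal for both claims, which is right because exactly one node is fed into it. -/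
theorem table_evaluates (S : Finset (Fin C.size)) :
    C.table.Evaluates fun i => ∃ h : i < C.size, C.Val S ⟨i, h⟩ := by
  intro n hn hin b
  obtain ⟨i, rfl⟩ : ∃ i : Fin C.size, i.1 = n := ⟨⟨n, hn⟩, rfl⟩
  have hval : ∀ j : Fin C.size, (∃ h : j.1 < C.size, C.Val S ⟨j.1, h⟩) ↔ C.Val S j := fun j =>
    ⟨fun ⟨_, h⟩ => h, fun h => ⟨j.2, h⟩⟩
  have hall : ∀ p : Prop, (∀ j < C.table.size, C.table.wire j i →
      ((∃ h : j < C.size, C.Val S ⟨j, h⟩) ↔ p)) ↔ ∀ j, C.wire j i = true → (C.Val S j ↔ p) := by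
    intro p
    refine ⟨fun h j hw => ?_, fun h j hj hw => ?_⟩
    · rw [← hval]
      exact h j j.2 ((table_wire_iff _ _).2 hw)
    · have := h ⟨j, hj⟩ ((table_wire_iff ⟨j, hj⟩ i).1 hw)
      rwa [← hval] at this
  have hex : ∀ p : Prop, (∃ j < C.table.size, C.table.wire j i ∧
      ((∃ h : j < C.size, C.Val S ⟨j, h⟩) ↔ p)) ↔ ∃ j, C.wire j i = true ∧ (C.Val S j ↔ p) := by
    intro p
    constructor
    · rintro ⟨j, hj, hw, h⟩
      exact ⟨⟨j, hj⟩, (table_wire_iff ⟨j, hj⟩ i).1 hw, by rwa [← hval]⟩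
    · rintro ⟨j, hw, h⟩
      exact ⟨j, j.2, (table_wire_iff _ _).2 hw, by rwa [hval]⟩
  beta_reduce
  rw [hval, hall, hex]
  rw [table_isInput_iff] at hin
  have hu : C.table.Univ b i ↔ (b ∧ C.kind i ≠ .or) ∨ (¬ b ∧ C.kind i ≠ .and) := by
    simp only [GateTable.Univ, table_isAnd_iff, table_isOr_iff, ne_eq]
  simp only [GateTable.Claim, table_isNot_iff]
  rw [Circuit.Val]
  cases hk : C.kind i with
  | input => exact absurd hk hin
  | not =>
    obtain ⟨j, hj, huniq⟩ := C.not_unary i hk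
    have h1 : ∀ p : Fin C.size → Prop, (∀ j, C.wire j i = true → p j) ↔ p j := fun p =>
      ⟨fun h => h j hj, fun h j' hj' => by rwa [huniq j' hj']⟩
    rw [if_pos (hu.2 (by simp [hk, em]))]
    by_cases hb : b <;> simp [hb, h1]
  | and =>
    by_cases hb : b
    · rw [if_pos (hu.2 (by simp [hk, hb]))]
      simp [hb]
    · rw [if_neg (fun h => by simpa [hk, hb] using hu.1 h)]
      simp [hb]
  | or =>
    by_cases hb : b
    · rw [if_neg (fun h => by simpa [hk, hb] using hu.1 h)]
      simp [hb]
    · rw [if_pos (hu.2 (by simp [hk, hb]))]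
      simp [hb]

/-! ### From bounds on paths to recursive bounds on depth and weft -/

theorem small_of_fanIn_le {i : Fin C.size} (h : C.fanIn i ≤ 2) : C.table.Small i := by
  unfold fanIn at h
  obtain ⟨l, r, hlr⟩ : ∃ l r : Fin C.size, ∀ j, C.wire j i = true → j = l ∨ j = r := by
    set s := Finset.univ.filter fun j => C.wire j i = true with hs
    have hmem : ∀ j, C.wire j i = true ↔ j ∈ s := fun j => by simp [hs]
    simp only [hmem]
    interval_cases hc : s.card
    · rw [Finset.card_eq_zero] at hc
      exact ⟨i, i, by simp [hc]⟩
    · obtain ⟨a, ha⟩ := Finset.card_eq_one.1 hc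
      exact ⟨a, a, by simp [ha]⟩
    · obtain ⟨a, b, -, hab⟩ := Finset.card_eq_two.1 hc
      exact ⟨a, b, by simp [hab]⟩
  refine ⟨l, l.2, r, r.2, fun j hj hw => ?_⟩
  have := hlr ⟨j, hj⟩ ((table_wire_iff ⟨j, hj⟩ i).1 hw)
  simpa [Fin.ext_iff] using this

/-- Directed paths from an input node to `i`. -/
def IsPathTo (C : Circuit) (i : Fin C.size) (l : List (Fin C.size)) : Prop :=
  l.IsChain (fun j i => C.wire j i = true) ∧ (∃ i, l.head? = some i ∧ C.kind i = .input) ∧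
  l.getLast? = some i

theorem IsPathTo.append {j i : Fin C.size} {l : List (Fin C.size)} (h : C.IsPathTo j l)
    (hw : C.wire j i = true) : C.IsPathTo i (l ++ [i]) := by
  obtain ⟨h1, ⟨x, h2, h2'⟩, h3⟩ := h
  refine ⟨?_, ⟨x, by simp [h2], h2'⟩, by simp⟩
  rw [List.isChain_append]
  refine ⟨h1, by simp, fun a ha b hb => ?_⟩
  rw [h3] at ha
  simp only [Option.mem_def, Option.some.injEq, List.head?_cons] at ha hb
  rwa [← ha, ← hb]

/-- Every gate is fed, so tracing wires backwards ends in an input. Without such a path, bounds on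
all paths would be vacuous. -/
theorem exists_isPathTo (i : Fin C.size) : ∃ l, C.IsPathTo i l := by
  induction i using WellFoundedLT.induction with
  | ind i ih =>
    by_cases hi : C.kind i = .input
    · exact ⟨[i], by simp, ⟨i, by simp, hi⟩, by simp⟩
    · obtain ⟨j, hj⟩ := C.gate_fed i hi
      obtain ⟨l, hl⟩ := ih j (C.wire_lt _ _ hj)
      exact ⟨_, hl.append hj⟩

/-- Appending a gate `i` to a path that ends in a node fed into `i` adds one gate, and one large
gate if `i` is not `Small`; so the bounds drop accordingly in the recursion. -/
theorem depthWeft_of_paths (e w : ℕ) (i : Fin C.size)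
    (hd : ∀ l, C.IsPathTo i l → l.countP (fun i => decide (C.kind i ≠ .input)) ≤ e)
    (hw : ∀ l, C.IsPathTo i l → l.countP (fun i => decide (2 < C.fanIn i)) ≤ w) :
    C.table.DepthWeft e w i := by
  induction e generalizing w i with
  | zero =>
    simp only [GateTable.DepthWeft, table_isInput_iff]
    by_contra hi
    obtain ⟨j, hj⟩ := C.gate_fed i hi
    obtain ⟨l, hl⟩ := exists_isPathTo j
    have := hd _ (hl.append hj)
    simp [List.countP_append, hi] at this
  | succ e ih =>
    simp only [GateTable.DepthWeft, table_isInput_iff]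
    by_cases hi : C.kind i = .input
    · exact .inl hi
    right
    have hd' : ∀ j, C.wire j i = true → ∀ l, C.IsPathTo j l →
        l.countP (fun i => decide (C.kind i ≠ .input)) ≤ e := fun j hj l hl => by
      have := hd _ (hl.append hj)
      simp only [List.countP_append, List.countP_singleton, decide_eq_true_eq, ne_eq, hi,
        not_false_eq_true, if_true] at this
      exact Nat.le_of_succ_le_succ this
    by_cases hs : C.table.Small i
    · refine .inl ⟨hi, hs, fun n hn hwn => ?_⟩
      have hj := (table_wire_iff ⟨n, hn⟩ i).1 hwn
      refine ih w ⟨n, hn⟩ (hd' _ hj) fun l hl => ?_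
      have := hw _ (hl.append hj)
      rw [List.countP_append] at this
      omega
    · have hlarge : 2 < C.fanIn i := by
        by_contra h
        exact hs (small_of_fanIn_le (by omega))
      have hw' : ∀ j, C.wire j i = true → ∀ l, C.IsPathTo j l →
          l.countP (fun i => decide (2 < C.fanIn i)) + 1 ≤ w := fun j hj l hl => by
        have := hw _ (hl.append hj)
        simpa only [List.countP_append, List.countP_singleton, decide_eq_true_eq, hlarge,
          if_true] using this
      obtain ⟨j, hj⟩ := C.gate_fed i hi
      obtain ⟨l, hl⟩ := exists_isPathTo j
      refine .inr ⟨hi, hs, by have := hw' j hj l hl; omega, fun n hn hwn => ?_⟩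
      have hj := (table_wire_iff ⟨n, hn⟩ i).1 hwn
      refine ih (w - 1) ⟨n, hn⟩ (hd' _ hj) fun l hl => ?_
      have := hw' _ hj l hl
      omega

end Circuit

/-- A local certificate for the claim that `i` is (is not) one of `X 1 - 1, …, X k - 1`. -/
def literalCert (m A k : ℕ) (b : Prop) (q w i : ℕ) : Prop :=
  (b ∧ (1 ≤ q % m ∧ (q % m ≤ k ∧ w % A = i + 1))) ∨
  (¬ b ∧ (q % m ≤ k ∧ (q / m % m = q % m + 1 ∧ (w % A < i + 1 ∧ i + 1 < w / A % A))))

/-- `X` lists the successors of `k` numbers below `N` in increasing order, between the sentinels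
`0` and `N + 1`. -/
structure Enumerates (X : ℕ → ℕ) (k N : ℕ) : Prop where
  zero : X 0 = 0
  last : X (k + 1) = N + 1
  lt_succ : ∀ t ≤ k, X t < X (t + 1)

theorem Enumerates.lt {X : ℕ → ℕ} {k N : ℕ} (h : Enumerates X k N) {s t : ℕ} (hst : s < t)
    (ht : t ≤ k + 1) : X s < X t := by
  induction t, hst using Nat.le_induction with
  | base => exact h.lt_succ s (by omega)
  | succ t hst ih => exact (ih (by omega)).trans (h.lt_succ t (by omega))

theorem exists_lt_sq_iff {m : ℕ} {P : ℕ → ℕ → Prop} :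
    (∃ q < m ^ 2, P (q % m) (q / m % m)) ↔ ∃ s < m, ∃ t < m, P s t := by
  rw [sq, GateTable.exists_lt_mul (P := fun s t => P s (t % m))]
  refine exists_congr fun s => and_congr_right fun _ => exists_congr fun t =>
    and_congr_right fun ht => ?_
  rw [Nat.mod_eq_of_lt ht]

/-- Occurrence is witnessed by one position. Absence is witnessed by two consecutive positions with
`i + 1` strictly between their entries, since `X` is increasing; the sentinels ensure that an absent
`i` always has such a pair. -/
theorem literalCert_iff {X : ℕ → ℕ} {k N m A : ℕ} (h : Enumerates X k N) (hm : k + 1 < m)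
    (hX : ∀ t < m, X t < A) {i : ℕ} (hi : i < N) (b : Prop) :
    ((∃ t, 1 ≤ t ∧ t ≤ k ∧ X t = i + 1) ↔ b) ↔
      ∃ q < m ^ 2, literalCert m A k b q (digitMap X m A 2 q) i := by
  have h0 : ∀ q, digitMap X m A 2 q % A = X (q % m) := fun q => by
    simpa using digitMap_digit (by omega) hX (show 0 < 2 by omega) q
  have h1 : ∀ q, digitMap X m A 2 q / A % A = X (q / m % m) := fun q => by
    simpa using digitMap_digit (by omega) hX (show 1 < 2 by omega) q
  simp only [literalCert, h0, h1]
  rw [exists_lt_sq_iff (P := fun s t => (b ∧ (1 ≤ s ∧ (s ≤ k ∧ X s = i + 1))) ∨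
    (¬ b ∧ (s ≤ k ∧ (t = s + 1 ∧ (X s < i + 1 ∧ i + 1 < X t)))))]
  by_cases hb : b
  · simp only [hb, iff_true, true_and, not_true_eq_false, false_and, or_false]
    exact ⟨fun ⟨t, h1, h2, h3⟩ => ⟨t, by omega, 0, by omega, h1, h2, h3⟩,
      fun ⟨t, _, _, _, h1, h2, h3⟩ => ⟨t, h1, h2, h3⟩⟩
  · simp only [hb, iff_false, true_and, not_false_eq_true, false_and, false_or]
    constructor
    · intro hne
      -- Position `0` qualifies because of the left sentinel, so the search succeeds; for `s = k`
      -- the right sentinel bounds `i + 1` from above.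
      set s := Nat.findGreatest (fun t => X t < i + 1) k with hs
      have hs1 : X s < i + 1 := by
        refine Nat.findGreatest_spec (P := fun t => X t < i + 1) (Nat.zero_le k) ?_
        rw [h.zero]
        omega
      have hsk : s ≤ k := Nat.findGreatest_le k
      refine ⟨s, by omega, s + 1, by omega, hsk, rfl, hs1, ?_⟩
      rcases hsk.lt_or_eq with hlt | heq
      · have h2 : ¬ X (s + 1) < i + 1 := Nat.findGreatest_is_greatest
          (P := fun t => X t < i + 1) (n := k) (by omega) (by omega)
        have h3 : X (s + 1) ≠ i + 1 := fun h => hne ⟨s + 1, by omega, by omega, h⟩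
        omega
      · rw [heq, h.last]
        omega
    · rintro ⟨s, -, _, -, hsk, rfl, h1, h2⟩ ⟨t, ht1, htk, ht⟩
      rcases lt_trichotomy t s with hlt | rfl | hlt
      · have := h.lt hlt (by omega)
        omega
      · omega
      · rcases Nat.lt_or_ge (s + 1) t with h3 | h3
        · have := h.lt h3 (by omega)
          omega
        · obtain rfl : t = s + 1 := by omega
          omega

/-- The size of the alphabet of the local constraints. -/
def GateTable.alphabet (G : GateTable) (d : ℕ) : ℕ := G.codes d + (G.size + 2)

/-- The local constraints. The constraint `j` stands for a strategy `j % G.codes d` of the refuter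
and a number `t = j / G.codes d ≤ k`. It looks at the values of `X` at `t`, `t + 1` and `k + 2` (the
strategy of the prover) and at the certificates for the game. -/
def GateTable.Local (G : GateTable) (out : ℕ → Prop) (d k j q w : ℕ) : Prop :=
  q / (k + 3) ^ 2 ^ (d + 1) % (k + 3) = j / G.codes d ∧
  (q / (k + 3) ^ (2 ^ (d + 1) + 1) % (k + 3) = j / G.codes d + 1 ∧
  (q / (k + 3) ^ (2 ^ (d + 1) + 2) % (k + 3) = k + 2 ∧
  (w / G.alphabet d ^ 2 ^ (d + 1) % G.alphabet d <
    w / G.alphabet d ^ (2 ^ (d + 1) + 1) % G.alphabet d ∧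
  ((j / G.codes d = 0 → w / G.alphabet d ^ 2 ^ (d + 1) % G.alphabet d = 0) ∧
  ((j / G.codes d ≠ 0 → G.IsInput (w / G.alphabet d ^ 2 ^ (d + 1) % G.alphabet d - 1)) ∧
  ((j / G.codes d = k → w / G.alphabet d ^ (2 ^ (d + 1) + 1) % G.alphabet d = G.size + 1) ∧
  (w / G.alphabet d ^ (2 ^ (d + 1) + 2) % G.alphabet d < G.codes d ∧
  ∃ o < G.size, out o ∧ G.Win (k + 3) (G.alphabet d) (literalCert (k + 3) (G.alphabet d) k) d 0 True
    (w / G.alphabet d ^ (2 ^ (d + 1) + 2) % G.alphabet d) (j % G.codes d)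
    (q % (k + 3) ^ 2 ^ (d + 1)) (w % G.alphabet d ^ 2 ^ (d + 1)) o)))))))

/-- The local constraints, in terms of `X`. -/
theorem GateTable.exists_local_iff {G : GateTable} {out : ℕ → Prop} {d k : ℕ} {X : ℕ → ℕ}
    (hX : ∀ i < k + 3, X i < G.alphabet d) {t J : ℕ} (ht : t ≤ k) (hJ : J < G.codes d) :
    (∃ q < (k + 3) ^ (2 ^ (d + 1) + 3), G.Local out d k (J + G.codes d * t) q
      (digitMap X (k + 3) (G.alphabet d) (2 ^ (d + 1) + 3) q)) ↔
    X t < X (t + 1) ∧ (t = 0 → X t = 0) ∧ (t ≠ 0 → G.IsInput (X t - 1)) ∧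
      (t = k → X (t + 1) = G.size + 1) ∧ X (k + 2) < G.codes d ∧
      ∃ q < (k + 3) ^ 2 ^ (d + 1), ∃ o < G.size, out o ∧
        G.Win (k + 3) (G.alphabet d) (literalCert (k + 3) (G.alphabet d) k) d 0 True (X (k + 2)) J q
          (digitMap X (k + 3) (G.alphabet d) (2 ^ (d + 1)) q) o := by
  have hm : 0 < k + 3 := by omega
  have e1 : (J + G.codes d * t) / G.codes d = t := by
    rw [Nat.add_mul_div_left _ _ (by omega), Nat.div_eq_of_lt hJ, zero_add]
  have e2 : (J + G.codes d * t) % G.codes d = J := by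
    rw [Nat.add_mul_mod_self_left, Nat.mod_eq_of_lt hJ]
  simp only [Local, e1, e2, digitMap_add_mod hm hX]
  have hd (a : ℕ) (ha : a < 3) (q : ℕ) := digitMap_digit hm hX
    (show 2 ^ (d + 1) + a < 2 ^ (d + 1) + 3 by omega) q
  have hd0 := hd 0 (by omega)
  have hd1 := hd 1 (by omega)
  have hd2 := hd 2 (by omega)
  simp only [Nat.add_zero] at hd0
  simp only [hd0, hd1, hd2]
  constructor
  · rintro ⟨q, -, h1, h2, h3, h⟩
    rw [h1, h2, h3] at h
    obtain ⟨h4, h5, h6, h7, h8, h9⟩ := h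
    exact ⟨h4, h5, h6, h7, h8, _, Nat.mod_lt _ (pow_pos hm _), h9⟩
  · rintro ⟨h4, h5, h6, h7, h8, q, hq, h9⟩
    have hq3 : t + (k + 3) * (t + 1 + (k + 3) * (k + 2)) < (k + 3) ^ 3 := by
      have : (k + 3) ^ 3 = (k + 3) * (k + 3) * (k + 2) + (k + 3) * (k + 3) := by ring
      have : (k + 3) * (t + 1 + (k + 3) * (k + 2)) =
        (k + 3) * (k + 3) * (k + 2) + (k + 3) * (t + 1) := by ring
      nlinarith
    -- The digits of `u` are the positions `t`, `t + 1` and `k + 2` that the constraint inspects;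
    -- they are placed above the certificate `q` of the game.
    set u := t + (k + 3) * (t + 1 + (k + 3) * (k + 2)) with hu
    have ed : (q + (k + 3) ^ 2 ^ (d + 1) * u) / (k + 3) ^ 2 ^ (d + 1) = u := by
      rw [Nat.add_mul_div_left _ _ (pow_pos hm _), Nat.div_eq_of_lt hq, zero_add]
    have em : (q + (k + 3) ^ 2 ^ (d + 1) * u) % (k + 3) ^ 2 ^ (d + 1) = q := by
      rw [Nat.add_mul_mod_self_left, Nat.mod_eq_of_lt hq]
    have u1 : u / (k + 3) = t + 1 + (k + 3) * (k + 2) := by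
      rw [hu, Nat.add_mul_div_left _ _ hm, Nat.div_eq_of_lt (by omega), zero_add]
    have u2 : u / (k + 3) ^ 2 = k + 2 := by
      rw [sq, ← Nat.div_div_eq_div_mul, u1, Nat.add_mul_div_left _ _ hm,
        Nat.div_eq_of_lt (by omega), zero_add]
    have q0 : u % (k + 3) = t := by
      rw [hu, Nat.add_mul_mod_self_left, Nat.mod_eq_of_lt (by omega)]
    have q1 : u / (k + 3) % (k + 3) = t + 1 := by
      rw [u1, Nat.add_mul_mod_self_left, Nat.mod_eq_of_lt (by omega)]
    have q2 : u / (k + 3) ^ 2 % (k + 3) = k + 2 := by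
      rw [u2, Nat.mod_eq_of_lt (by omega)]
    refine ⟨q + (k + 3) ^ 2 ^ (d + 1) * u, ?_, ?_⟩
    · calc q + (k + 3) ^ 2 ^ (d + 1) * u
          < (k + 3) ^ 2 ^ (d + 1) + (k + 3) ^ 2 ^ (d + 1) * u := by omega
        _ = (k + 3) ^ 2 ^ (d + 1) * (u + 1) := by ring
        _ ≤ (k + 3) ^ 2 ^ (d + 1) * (k + 3) ^ 3 := Nat.mul_le_mul_left _ hq3
        _ = _ := (pow_add _ _ _).symm
    · rw [pow_add _ (2 ^ (d + 1)) 1, pow_add _ (2 ^ (d + 1)) 2, pow_one (k + 3), ← Nat.div_div_eq_div_mul,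
        ← Nat.div_div_eq_div_mul, ed, em, q0, q1, q2]
      exact ⟨rfl, rfl, rfl, h4, h5, h6, h7, h8, h9⟩

/-- The local constraints express that the circuit has a satisfying assignment of weight `k`. -/
theorem Circuit.local_iff_weightedSat {C : Circuit} {d : ℕ} (hweft : C.WeftLE 2)
    (hdepth : C.DepthLE d) (k : ℕ) :
    (∃ X : ℕ → ℕ, (∀ i < k + 3, X i < C.table.alphabet d) ∧
      ∀ j < C.table.codes d * (k + 1), ∃ q < (k + 3) ^ (2 ^ (d + 1) + 3),
        C.table.Local (fun o => o = C.out) d k j q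
          (digitMap X (k + 3) (C.table.alphabet d) (2 ^ (d + 1) + 3) q)) ↔ C.WeightedSat k := by
  have hN : 0 < C.table.size := C.size_pos
  have hsize : C.table.size = C.size := rfl
  have hout : C.out.1 < C.table.size := C.out.2
  have hdw : C.table.DepthWeft d 2 C.out := depthWeft_of_paths d 2 C.out hdepth hweft
  have hcodes := GateTable.codes_pos (G := C.table) hN d
  -- Once `X` is known to enumerate `S`, the certified game is the game with the true values at the
  -- inputs. The latter ignores `q` and `w`, for which `0` is put.
  have key : ∀ X : ℕ → ℕ, (∀ i < k + 3, X i < C.table.alphabet d) →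
      ∀ S : Finset (Fin C.size), Enumerates X k C.size →
      (∀ i, i ∈ S ↔ ∃ t, 1 ≤ t ∧ t ≤ k ∧ X t = i.1 + 1) → ∀ J,
      (C.table.Win (k + 3) (C.table.alphabet d)
        (fun b _ _ i => (∃ h : i < C.size, C.Val S ⟨i, h⟩) ↔ b) d 0 True (X (k + 2)) J 0 0 C.out ↔
      ∃ q < (k + 3) ^ 2 ^ (d + 1), ∃ o < C.table.size, o = C.out.1 ∧
        C.table.Win (k + 3) (C.table.alphabet d) (literalCert (k + 3) (C.table.alphabet d) k) d 0
          True (X (k + 2)) J q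
          (digitMap X (k + 3) (C.table.alphabet d) (2 ^ (d + 1)) q) o) := by
    intro X hX S henum hS J
    rw [GateTable.win_certificate table_fed hN (by omega) hX (fun b i hi hin => ?_) d 0 True
      (X (k + 2)) J 0 0 hout]
    · refine exists_congr fun q => and_congr_right fun _ => ⟨fun h => ⟨_, hout, rfl, h⟩, ?_⟩
      rintro ⟨o, -, rfl, h⟩
      exact h
    · rw [← literalCert_iff henum (by omega) hX hi]
      have hk := (table_isInput_iff ⟨i, hi⟩).1 hin
      have : (∃ h : i < C.size, C.Val S ⟨i, h⟩) ↔ ∃ t, 1 ≤ t ∧ t ≤ k ∧ X t = i + 1 := by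
        rw [← hS ⟨i, hi⟩]
        have hval : C.Val S ⟨i, hi⟩ ↔ ⟨i, hi⟩ ∈ S := by
          rw [Circuit.Val]
          simp [hk]
        rw [← hval]
        exact ⟨fun ⟨_, h⟩ => h, fun h => ⟨hi, h⟩⟩
      rw [this]
  constructor
  · rintro ⟨X, hX, h⟩
    have h' : ∀ t ≤ k, ∀ J < C.table.codes d, _ := fun t ht J hJ =>
      (GateTable.exists_local_iff hX ht hJ).1 (h (J + C.table.codes d * t) (by
        calc J + C.table.codes d * t < C.table.codes d + C.table.codes d * t := by omega
          _ = C.table.codes d * (t + 1) := by ring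
          _ ≤ _ := Nat.mul_le_mul_left _ (by omega)))
    -- The conditions on the shape of `X` do not depend on the strategy of the refuter, so strategy
    -- `0` suffices.
    have henum : Enumerates X k C.size :=
      ⟨(h' 0 (by omega) 0 hcodes).2.1 rfl, (h' k le_rfl 0 hcodes).2.2.2.1 rfl,
        fun t ht => (h' t ht 0 hcodes).1⟩
    have hlt : ∀ t : Fin k, X (t + 1) - 1 < C.size := fun t => by
      have h1 := henum.lt (s := t + 1) (t := k + 1) (by omega) le_rfl
      rw [henum.last] at h1
      have h2 := henum.lt (s := 0) (t := t + 1) (by omega) (by omega)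
      omega
    let x : Fin k → Fin C.size := fun t => ⟨X (t + 1) - 1, hlt t⟩
    have hxpos : ∀ t : Fin k, X (t + 1) = (x t).1 + 1 := fun t => by
      have := henum.lt (s := 0) (t := t + 1) (by omega) (by omega)
      simp only [x]
      omega
    have hinj : Function.Injective x := by
      intro s t hst
      by_contra hne
      have h1 : X (s + 1) = X (t + 1) := by rw [hxpos, hxpos, hst]
      rcases lt_or_gt_of_ne (fun h => hne (Fin.ext h) : s.1 ≠ t.1) with h2 | h2
      · have := henum.lt (s := s + 1) (t := t + 1) (by omega) (by omega)
        omega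
      · have := henum.lt (s := t + 1) (t := s + 1) (by omega) (by omega)
        omega
    refine ⟨Finset.univ.image x, ?_, ?_, ?_⟩
    · intro i hi
      obtain ⟨t, -, rfl⟩ := Finset.mem_image.1 hi
      exact (table_isInput_iff _).1 ((h' (t + 1) (by omega) 0 hcodes).2.2.1 (by omega))
    · rw [Finset.card_image_of_injective _ hinj]
      simp
    · have hS : ∀ i, i ∈ Finset.univ.image x ↔ ∃ t, 1 ≤ t ∧ t ≤ k ∧ X t = i.1 + 1 := by
        intro i
        simp only [Finset.mem_image, Finset.mem_univ, true_and]
        constructor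
        · rintro ⟨t, rfl⟩
          exact ⟨t + 1, by omega, by omega, hxpos t⟩
        · rintro ⟨t, h1, h2, h3⟩
          refine ⟨⟨t - 1, by omega⟩, Fin.ext ?_⟩
          simp only [x]
          rw [Nat.sub_add_cancel h1, h3]
          rfl
      have hwin := (GateTable.win_iff_of_weft_two (m := k + 3) (A := C.table.alphabet d)
        table_fed hN (table_evaluates (Finset.univ.image x)) hout hdw True 0 0).1
        ⟨X (k + 2), (h' 0 (by omega) 0 hcodes).2.2.2.2.1, fun J hJ =>
          (key X hX _ henum hS J).2 (h' 0 (by omega) J hJ).2.2.2.2.2⟩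
      exact (hwin.2 trivial).2
  · rintro ⟨S, hSin, hcard, hval⟩
    obtain ⟨Y, hY, hwin⟩ := (GateTable.win_iff_of_weft_two (m := k + 3) (A := C.table.alphabet d)
      table_fed hN (table_evaluates S) hout hdw True 0 0).2 ⟨fun _ => trivial, fun _ => ⟨C.out.2, hval⟩⟩
    let x := S.orderEmbOfFin hcard
    -- Nodes are shifted by one to leave `0` free as left sentinel; the last position `k + 2` holds
    -- the prover's strategy.
    let X : ℕ → ℕ := fun t => if h : 1 ≤ t ∧ t ≤ k then (x ⟨t - 1, by omega⟩).1 + 1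
      else if t = 0 then 0 else if t = k + 1 then C.size + 1 else Y
    have hXmid : ∀ t : Fin k, X (t + 1) = (x t).1 + 1 := fun t => by
      have : 1 ≤ t.1 + 1 ∧ t.1 + 1 ≤ k := by omega
      simp only [X, this, and_self, dif_pos]
      rfl
    have hXY : X (k + 2) = Y := by simp [X]
    have henum : Enumerates X k C.size := by
      refine ⟨by simp [X], by simp [X], fun t ht => ?_⟩
      rcases Nat.eq_zero_or_pos t with rfl | hpos
      · rcases Nat.eq_zero_or_pos k with rfl | hk
        · simp [X]
        · rw [hXmid ⟨0, hk⟩]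
          simp [X]
      · obtain ⟨t, rfl⟩ : ∃ s, t = s + 1 := ⟨t - 1, by omega⟩
        rw [hXmid ⟨t, by omega⟩]
        rcases ht.lt_or_eq with hlt | heq
        · have h2 := hXmid ⟨t + 1, hlt⟩
          have h3 : x ⟨t, by omega⟩ < x ⟨t + 1, hlt⟩ := x.strictMono (by simp)
          simp only at h2
          rw [h2]
          exact Nat.succ_lt_succ h3
        · have : X (t + 1 + 1) = C.size + 1 := by rw [heq]; simp [X]
          rw [this]
          have := (x ⟨t, by omega⟩).2
          omega
    have hX : ∀ i < k + 3, X i < C.table.alphabet d := by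
      intro i hi
      simp only [GateTable.alphabet, hsize]
      rcases Nat.lt_or_ge i (k + 2) with h | h
      · have : X i ≤ C.size + 1 := by
          rw [← henum.last]
          rcases (Nat.lt_succ_iff.1 h).lt_or_eq with h | h
          · exact (henum.lt h le_rfl).le
          · rw [h]
        omega
      · obtain rfl : i = k + 2 := by omega
        omega
    have hS : ∀ i, i ∈ S ↔ ∃ t, 1 ≤ t ∧ t ≤ k ∧ X t = i.1 + 1 := by
      intro i
      constructor
      · intro hi
        have : i ∈ Set.range x := by
          rw [Finset.range_orderEmbOfFin]
          exact hi
        obtain ⟨t, rfl⟩ := this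
        exact ⟨t + 1, by omega, by omega, hXmid t⟩
      · rintro ⟨t, h1, h2, h3⟩
        have h4 := hXmid ⟨t - 1, by omega⟩
        simp only [Nat.sub_add_cancel h1] at h4
        have : i = x ⟨t - 1, by omega⟩ := Fin.ext (by omega)
        rw [this]
        exact Finset.orderEmbOfFin_mem _ _ _
    refine ⟨X, hX, fun j hj => ?_⟩
    have ht : j / C.table.codes d ≤ k := Nat.lt_succ_iff.1 (Nat.div_lt_of_lt_mul hj)
    rw [← Nat.mod_add_div j (C.table.codes d),
      GateTable.exists_local_iff hX ht (Nat.mod_lt _ hcodes)]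
    refine ⟨henum.lt_succ _ ht, fun h => by rw [h, henum.zero], fun h => ?_,
      fun h => by rw [h, henum.last, hsize], by omega, ?_⟩
    · generalize j / C.table.codes d = t at h ht
      have h4 := hXmid ⟨t - 1, by omega⟩
      simp only [Nat.sub_add_cancel (Nat.pos_of_ne_zero h)] at h4
      rw [h4, Nat.add_sub_cancel, table_isInput_iff]
      exact hSin _ (Finset.orderEmbOfFin_mem _ _ _)
    · rw [← key X hX S henum hS, hXY]
      exact hwin _ (Nat.mod_lt _ hcodes)

end ParamComplexity

namespace ParamComplexity

open Context

/-! ### The reduction is computable in polynomial time -/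

theorem tape_eq_two_iff {x : List Bool} {i : ℕ} : tape x i = 2 ↔ x[i]? = some true := by
  unfold tape
  split <;> simp_all

/-- The number of nodes of a circuit, read off its encoding. -/
def rawSize (x : List Bool) : ℕ :=
  ∑ i ∈ Finset.range x.length, if ∀ j < i + 1, tape x j = 2 then 1 else 0

/-- The table of a circuit, read off its encoding. -/
def rawTable (x : List Bool) : GateTable where
  size := rawSize x
  bit₁ i := i < rawSize x ∧ tape x (rawSize x + 1 + i) = 2
  bit₂ i := i < rawSize x ∧ tape x (rawSize x + 1 + (rawSize x + i)) = 2
  wire j i := j < rawSize x ∧ (i < rawSize x ∧ tape x (rawSize x + 1 + (rawSize x + (rawSize x +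
    (rawSize x + (j * rawSize x + i))))) = 2)

/-- The output node of a circuit, read off its encoding. -/
def rawOut (x : List Bool) (i : ℕ) : Prop :=
  i < rawSize x ∧ tape x (rawSize x + 1 + (rawSize x + (rawSize x + i))) = 2

/-! ### Reading the encodings cell by cell -/

theorem getElem?_append_add {a : List Bool} (b : List Bool) {n : ℕ} (h : a.length = n) (i : ℕ) :
    (a ++ b)[n + i]? = b[i]? := by
  rw [List.getElem?_append_right (by omega), h, Nat.add_sub_cancel_left]

theorem getElem?_ofFn_append {n : ℕ} (f : Fin n → Bool) (b : List Bool) (i : Fin n) :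
    (List.ofFn f ++ b)[i.1]? = some (f i) := by
  rw [List.getElem?_append_left (by simp)]
  simp

theorem getElem?_matrixBits {n : ℕ} (M : Fin n → Fin n → Bool) (i j : Fin n) :
    (matrixBits M)[i.1 * n + j.1]? = some (M i j) := by
  have hlt : i.1 * n + j.1 < n * n := by
    calc i.1 * n + j.1 < i.1 * n + n := by omega
      _ = (i.1 + 1) * n := by ring
      _ ≤ n * n := Nat.mul_le_mul_right _ i.2
  have hn : 0 < n := (Nat.zero_le _).trans_lt i.2
  simp only [matrixBits, List.getElem?_ofFn, hlt, dif_pos, Option.some.injEq]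
  congr 1
  · apply Fin.ext
    rw [Fin.coe_divNat]
    change (i.1 * n + j.1) / n = i
    rw [mul_comm, Nat.mul_add_div hn, Nat.div_eq_of_lt j.2, Nat.add_zero]
  · apply Fin.ext
    rw [Fin.coe_modNat]
    change (i.1 * n + j.1) % n = j
    rw [mul_comm, Nat.mul_add_mod, Nat.mod_eq_of_lt j.2]

theorem length_unary (n : ℕ) : (unary n).length = n + 1 := by simp [unary]

theorem getElem?_unary_append (n : ℕ) (b : List Bool) {i : ℕ} (hi : i ≤ n) :
    (unary n ++ b)[i]? = some (decide (i < n)) := by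
  rw [List.getElem?_append_left (by rw [length_unary]; omega), unary]
  rcases hi.lt_or_eq with h | rfl
  · rw [List.getElem?_append_left (by simpa using h)]
    simp [h]
  · rw [List.getElem?_append_right (by simp)]
    simp

namespace Circuit

theorem encode_eq (C : Circuit) : C.encode = unary C.size ++
    (List.ofFn (fun i => (C.kind i).bits.1) ++ (List.ofFn (fun i => (C.kind i).bits.2) ++
      (List.ofFn (fun i => decide (i = C.out)) ++ matrixBits C.wire))) := by
  simp only [encode, List.append_assoc]

/-- The number of nonempty prefixes that consist of `true` only is the length of the leading block
of the unary code, which its closing `false` ends. -/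
theorem rawSize_encode (C : Circuit) : rawSize C.encode = C.size := by
  have h : ∀ i, (∀ j < i + 1, tape C.encode j = 2) ↔ i < C.size := by
    intro i
    constructor
    · intro h
      by_contra hi
      have := h C.size (by omega)
      rw [tape_eq_two_iff, encode_eq, getElem?_unary_append _ _ le_rfl] at this
      simp at this
    · intro hi j hj
      rw [tape_eq_two_iff, encode_eq, getElem?_unary_append _ _ (by omega)]
      simp
      omega
  have hlen : C.size ≤ C.encode.length := by
    rw [encode_eq, List.length_append, length_unary]
    omega
  simp only [rawSize, h]
  rw [← Finset.sum_filter]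
  have : (Finset.range C.encode.length).filter (· < C.size) = Finset.range C.size := by
    ext i
    simp only [Finset.mem_filter, Finset.mem_range]
    omega
  rw [this]
  simp

/-- Because of the range conditions in `rawTable`, the tables agree on all numbers and not just on
nodes, so they are equal and one can be rewritten into the other. -/
theorem rawTable_encode (C : Circuit) : rawTable C.encode = C.table := by
  simp only [rawTable, table, rawSize_encode, tape_eq_two_iff]
  rw [encode_eq]
  simp only [getElem?_append_add _ (length_unary _), getElem?_append_add _ (List.length_ofFn)]
  congr 1
  · funext i
    rw [← exists_prop]
    exact propext (exists_congr fun h => by rw [getElem?_ofFn_append _ _ ⟨i, h⟩]; simp)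
  · funext i
    rw [← exists_prop]
    exact propext (exists_congr fun h => by rw [getElem?_ofFn_append _ _ ⟨i, h⟩]; simp)
  · funext j i
    rw [← exists_prop]
    refine propext (exists_congr fun hj => ?_)
    rw [← exists_prop]
    exact exists_congr fun hi => by rw [getElem?_matrixBits _ ⟨j, hj⟩ ⟨i, hi⟩]; simp

theorem rawOut_encode (C : Circuit) : rawOut C.encode = fun o => o = C.out.1 := by
  funext i
  simp only [rawOut, rawSize_encode, tape_eq_two_iff]
  rw [encode_eq]
  simp only [getElem?_append_add _ (length_unary _), getElem?_append_add _ (List.length_ofFn)]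
  rw [← exists_prop]
  refine propext ⟨fun ⟨h, h'⟩ => ?_, fun h => ⟨h ▸ C.out.2, ?_⟩⟩
  · rw [getElem?_ofFn_append _ _ ⟨i, h⟩] at h'
    simpa [Fin.ext_iff] using h'
  · subst h
    rw [getElem?_ofFn_append]
    simp

end Circuit

/-! ### Gates, certificates and the game are decidable in polynomial time -/

section PolyPred

variable {α : Type} [Context α]

theorem polyFun_rawSize : PolyFun fun a : α => rawSize (base a).1 := by
  have : PolyPred fun a : α × ℕ => ∀ j < a.2 + 1, tape (base a.1).1 j = 2 :=
    .forall_lt (PolyFun.snd.add (.const 1)) (.eq (PolyFun.tape (α := (α × ℕ) × ℕ) .snd) (.const 2))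
  exact PolyFun.length.sum (g := fun a : α × ℕ => if ∀ j < a.2 + 1, tape (base a.1).1 j = 2 then 1
    else 0) this.indicator

variable {i j : α → ℕ} (hi : PolyFun i) (hj : PolyFun j)

include hi in
theorem polyPred_bit₁ : PolyPred fun a => (rawTable (base a).1).bit₁ (i a) :=
  .and (.lt hi polyFun_rawSize) (.eq (.tape ((polyFun_rawSize.add (.const 1)).add hi)) (.const 2))

include hi in
theorem polyPred_bit₂ : PolyPred fun a => (rawTable (base a).1).bit₂ (i a) :=
  .and (.lt hi polyFun_rawSize) (.eq (.tape ((polyFun_rawSize.add (.const 1)).add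
    (polyFun_rawSize.add hi))) (.const 2))

include hi in
theorem polyPred_rawOut : PolyPred fun a => rawOut (base a).1 (i a) :=
  .and (.lt hi polyFun_rawSize) (.eq (.tape ((polyFun_rawSize.add (.const 1)).add
    (polyFun_rawSize.add (polyFun_rawSize.add hi)))) (.const 2))

include hi hj in
theorem polyPred_wire : PolyPred fun a => (rawTable (base a).1).wire (j a) (i a) :=
  .and (.lt hj polyFun_rawSize) (.and (.lt hi polyFun_rawSize) (.eq (.tape
    ((polyFun_rawSize.add (.const 1)).add (polyFun_rawSize.add (polyFun_rawSize.add
      (polyFun_rawSize.add ((hj.mul polyFun_rawSize).add hi)))))) (.const 2)))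

include hi in
theorem polyPred_isInput : PolyPred fun a => (rawTable (base a).1).IsInput (i a) :=
  .and (polyPred_bit₁ hi).not (polyPred_bit₂ hi).not

include hi in
theorem polyPred_univ {b : α → Prop} (hb : PolyPred b) :
    PolyPred fun a => (rawTable (base a).1).Univ (b a) (i a) :=
  .or (.and hb (.not (.and (polyPred_bit₁ hi) (polyPred_bit₂ hi))))
    (.and hb.not (.not (.and (polyPred_bit₁ hi) (polyPred_bit₂ hi).not)))

include hi in
theorem polyPred_claim {b : α → Prop} (hb : PolyPred b) :
    PolyPred fun a => (rawTable (base a).1).Claim (b a) (i a) :=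
  .iff hb (.not (.and (polyPred_bit₁ hi).not (polyPred_bit₂ hi)))

include hi hj in
theorem polyPred_first : PolyPred fun a => (rawTable (base a).1).First (j a) (i a) :=
  .forall_lt hj (polyPred_wire hi.lift .snd).not

include hi in
theorem polyPred_small : PolyPred fun a => (rawTable (base a).1).Small (i a) :=
  .exists_lt polyFun_rawSize (.exists_lt polyFun_rawSize (.forall_lt polyFun_rawSize
    (.imp (polyPred_wire hi.lift.lift.lift .snd)
      (.or (.eq .snd PolyFun.snd.lift.lift) (.eq .snd PolyFun.snd.lift)))))

theorem polyFun_codes (e : ℕ) : PolyFun fun a : α => (rawTable (base a).1).codes e := by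
  induction e with
  | zero => exact .const 1
  | succ e ih => exact polyFun_rawSize.mul (ih.mul ih)

theorem polyFun_alphabet (d : ℕ) : PolyFun fun a : α => (rawTable (base a).1).alphabet d :=
  (polyFun_codes d).add (polyFun_rawSize.add (.const 2))

include hi in
theorem polyPred_literalCert {m A k q w : α → ℕ} {b : α → Prop} (hm : PolyFun m) (hA : PolyFun A)
    (hk : PolyFun k) (hb : PolyPred b) (hq : PolyFun q) (hw : PolyFun w) :
    PolyPred fun a => literalCert (m a) (A a) (k a) (b a) (q a) (w a) (i a) :=
  .or (.and hb (.and (.le (.const 1) (hq.mod hm)) (.and (.le (hq.mod hm) hk)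
      (.eq (hw.mod hA) (hi.add (.const 1))))))
    (.and hb.not (.and (.le (hq.mod hm) hk) (.and
      (.eq ((hq.div hm).mod hm) ((hq.mod hm).add (.const 1)))
      (.and (.lt (hw.mod hA) (hi.add (.const 1)))
        (.lt (hi.add (.const 1)) ((hw.div hA).mod hA))))))

end PolyPred

/-- For fixed `e` and `c` the recursion unfolds to a formula of constant size with constant
exponents. The induction ranges over all contexts, since the quantifiers in `Step` pass from `α` to
`α × ℕ`. -/
theorem polyPred_win (e : ℕ) : ∀ (c : ℕ) {α : Type} [Context α] {b : α → Prop}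
    {m A k Y J q w i : α → ℕ}, PolyFun m → PolyFun A → PolyFun k → PolyPred b → PolyFun Y →
    PolyFun J → PolyFun q → PolyFun w → PolyFun i →
    PolyPred fun a => (rawTable (base a).1).Win (m a) (A a) (literalCert (m a) (A a) (k a)) e c (b a)
      (Y a) (J a) (q a) (w a) (i a) := by
  induction e with
  | zero =>
    intro c α _ b m A k Y J q w i hm hA hk hb hY hJ hq hw hi
    exact .and (polyPred_isInput hi) (polyPred_literalCert hi hm hA hk hb hq hw)
  | succ e ih =>
    intro c α _ b m A k Y J q w i hm hA hk hb hY hJ hq hw hi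
    have hN := polyFun_rawSize (α := α)
    have hC := polyFun_codes (α := α) e
    have hcl := polyPred_claim hi hb
    have hY₁ := (hY.div hN).mod hC
    have hY₂ := (hY.div hN).div hC
    have hJ₁ := (hJ.div hN).mod hC
    have hJ₂ := (hJ.div hN).div hC
    have hq₁ := hq.mod (hm.pow (2 ^ (e + 1)))
    have hq₂ := hq.div (hm.pow (2 ^ (e + 1)))
    have hw₁ := hw.mod (hA.pow (2 ^ (e + 1)))
    have hw₂ := hw.div (hA.pow (2 ^ (e + 1)))
    have hgate := (polyPred_isInput hi).not
    have hsmall := polyPred_small hi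
    have huniv := polyPred_univ hi hb
    have hwire := polyPred_wire hi.lift (PolyFun.snd (α := α))
    have hfirst := polyPred_first hi.lift (PolyFun.snd (α := α))
    have hW₁ (c : ℕ) := ih c hm.lift hA.lift hk.lift hcl.lift hY₁.lift hJ₁.lift hq₁.lift hw₁.lift
      (PolyFun.snd (α := α))
    have hW₂ (c : ℕ) := ih c hm.lift hA.lift hk.lift hcl.lift hY₂.lift hJ₂.lift hq₂.lift hw₂.lift
      (PolyFun.snd (α := α))
    have hx := hJ.mod hN
    have hy := hY.mod hN
    exact .or (.and (polyPred_isInput hi) (ih c hm hA hk hb hY₁ hJ₁ hq₁ hw₁ hi))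
      (.or (.and hgate (.and hsmall (.and huniv (.forall_lt hN (.imp hwire
        (.and (.imp hfirst (hW₁ c)) (.imp hfirst.not (hW₂ c))))))))
      (.or (.and hgate (.and hsmall (.and huniv.not (.exists_lt hN (.and hwire
        (.or (.and hfirst (hW₁ c)) (.and hfirst.not (hW₂ c))))))))
      (.or (.and hgate (.and hsmall.not (.and huniv (.imp (polyPred_wire hi hx)
        (ih (c + 1) hm hA hk hcl hY₁ hJ₁ hq₁ hw₁ hx)))))
      (.or (.and hgate (.and hsmall.not (.and huniv.not (.and (.const _) (.and (polyPred_wire hi hy)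
        (ih (c + 1) hm hA hk hcl hY₁ hJ₁ hq₁ hw₁ hy))))))
      (.and hgate (.and hsmall.not (.and huniv.not (.and (.const _)
        (.exists_lt hN (.and hwire (hW₁ (c + 1))))))))))))

/-! ### The graph of the reduction and its computation -/

section Reduction

variable {α : Type} [Context α]

theorem polyPred_local (d : ℕ) {j q w : α → ℕ} (hj : PolyFun j) (hq : PolyFun q)
    (hw : PolyFun w) : PolyPred fun a => (rawTable (base a).1).Local (rawOut (base a).1) d (base a).2
      (j a) (q a) (w a) := by
  have hm := (PolyFun.param (α := α)).add (.const 3)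
  have hA := polyFun_alphabet (α := α) d
  have hC := polyFun_codes (α := α) d
  have hN := polyFun_rawSize (α := α)
  have ht := hj.div hC
  have hq' (a : ℕ) := (hq.div (hm.pow a)).mod hm
  have hw' (a : ℕ) := (hw.div (hA.pow a)).mod hA
  exact .and (.eq (hq' _) ht) (.and (.eq (hq' _) (ht.add (.const 1)))
    (.and (.eq (hq' _) (PolyFun.param.add (.const 2))) (.and (.lt (hw' _) (hw' _))
    (.and (.imp (.eq ht (.const 0)) (.eq (hw' _) (.const 0)))
    (.and (.imp (.ne ht (.const 0)) (polyPred_isInput ((hw' _).sub (.const 1))))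
    (.and (.imp (.eq ht .param) (.eq (hw' _) (hN.add (.const 1))))
    (.and (.lt (hw' _) hC) (.exists_lt hN (.and (polyPred_rawOut .snd)
      (polyPred_win d 0 hm.lift hA.lift PolyFun.param.lift (.const True) (hw' _).lift
        (hj.mod hC).lift (hq.mod (hm.pow _)).lift (hw.mod (hA.pow _)).lift .snd))))))))))

/-- The number of colours. -/
def colours (d : ℕ) (I : List Bool × ℕ) : ℕ := (I.2 + 3) ^ (2 ^ (d + 1) + 3)

/-- The number of values of a colour. -/
def values (d : ℕ) (I : List Bool × ℕ) : ℕ :=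
  (rawTable I.1).alphabet d ^ (2 ^ (d + 1) + 3)

/-- The number of local constraints. -/
def constraints (d : ℕ) (I : List Bool × ℕ) : ℕ := (rawTable I.1).codes d * (I.2 + 1)

/-- The number of sets to be hit. -/
def hittingSets (d : ℕ) (I : List Bool × ℕ) : ℕ :=
  constraints d I + colours d I * (values d I * (I.2 + 3))

/-- Membership of coloured values in the sets to be hit. -/
def reductionMem (d : ℕ) (I : List Bool × ℕ) : ℕ → ℕ → ℕ → Prop :=
  localMem (I.2 + 3) ((rawTable I.1).alphabet d) (2 ^ (d + 1) + 3) (constraints d I)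
    ((rawTable I.1).Local (rawOut I.1) d I.2)

/-- The number of vertices. -/
def vertices (d : ℕ) (I : List Bool × ℕ) : ℕ :=
  colours d I * values d I + colours d I + hittingSets d I

/-- The graph of the reduction. -/
def reductionGraph (d : ℕ) (I : List Bool × ℕ) : SimpleGraph (Fin (vertices d I)) :=
  hittingGraph (colours d I) (values d I) (hittingSets d I) (reductionMem d I)

theorem polyFun_colours (d : ℕ) : PolyFun fun a : α => colours d (base a) :=
  (PolyFun.param.add (.const 3)).pow _

theorem polyFun_values (d : ℕ) : PolyFun fun a : α => values d (base a) :=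
  (polyFun_alphabet d).pow _

theorem polyFun_constraints (d : ℕ) : PolyFun fun a : α => constraints d (base a) :=
  (polyFun_codes d).mul (PolyFun.param.add (.const 1))

theorem polyFun_vertices (d : ℕ) : PolyFun fun a : α => vertices d (base a) :=
  (((polyFun_colours d).mul (polyFun_values d)).add (polyFun_colours d)).add
    ((polyFun_constraints d).add ((polyFun_colours d).mul ((polyFun_values d).mul
      (PolyFun.param.add (.const 3)))))

theorem polyPred_reductionMem (d : ℕ) {f Q w : α → ℕ} (hf : PolyFun f) (hQ : PolyFun Q)
    (hw : PolyFun w) : PolyPred fun a => reductionMem d (base a) (f a) (Q a) (w a) := by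
  have hJ := polyFun_constraints (α := α) d
  have hm := (PolyFun.param (α := α)).add (.const 3)
  have hA := polyFun_alphabet (α := α) d
  have hg := hf.sub hJ
  have hq := hg.mod (hm.pow (2 ^ (d + 1) + 3))
  have hv := (hg.div (hm.pow (2 ^ (d + 1) + 3))).mod (hA.pow (2 ^ (d + 1) + 3))
  have hi := (hg.div (hm.pow (2 ^ (d + 1) + 3))).div (hA.pow (2 ^ (d + 1) + 3))
  exact .or (.and (.lt hf hJ) (polyPred_local d hf hQ hw)) (.and (.le hJ hf)
    (.or (.and (.eq hQ hq) (.ne hw hv)) (.and (.eq hQ hi) (.forall_lt_const _ fun a _ =>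
      .imp (.eq ((hq.div (hm.pow a)).mod hm) hi) (.eq ((hv.div (hA.pow a)).mod hA) (hw.mod hA))))))

theorem polyPred_hittingRel (d : ℕ) {u v : α → ℕ} (hu : PolyFun u) (hv : PolyFun v) :
    PolyPred fun a => hittingRel (colours d (base a)) (values d (base a)) (reductionMem d (base a))
      (u a) (v a) := by
  have hK := polyFun_colours (α := α) d
  have hL := polyFun_values (α := α) d
  have hKL := hK.mul hL
  have hKLK := hKL.add hK
  exact .or (.and (.lt hu hKL) (.lt hv hKL))
    (.or (.and (.lt hu hKL) (.and (.le hKL hv) (.and (.lt hv hKLK)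
      (.eq (hu.div hL) (hv.sub hKL)))))
    (.or (.and (.lt hu hKL) (.and (.le hKLK hv)
      (polyPred_reductionMem d (hv.sub hKLK) (hu.div hL) (hu.mod hL))))
    (.and (.le hKLK hu) (.le hKLK hv))))

/-- Adjacency in the graph of the reduction, as a relation on numbers. -/
def reductionAdj (d : ℕ) (I : List Bool × ℕ) (u v : ℕ) : Prop :=
  u ≠ v ∧ (hittingRel (colours d I) (values d I) (reductionMem d I) u v ∨
    hittingRel (colours d I) (values d I) (reductionMem d I) v u)

theorem reductionGraph_adj {d : ℕ} {I : List Bool × ℕ} {u v : Fin (vertices d I)} :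
    (reductionGraph d I).Adj u v ↔ reductionAdj d I u v := by
  refine (SimpleGraph.fromRel_adj (fun u v : Fin (vertices d I) =>
    hittingRel (colours d I) (values d I) (reductionMem d I) u v) u v).trans ?_
  rw [reductionAdj, Ne, Fin.ext_iff]

open Classical in
/-- The output of the reduction on the tape. -/
noncomputable def reductionOut (d : ℕ) (a : (List Bool × ℕ) × ℕ) : ℕ :=
  if a.2 < vertices d a.1 then 2 else if a.2 = vertices d a.1 then 1 else
    if reductionAdj d a.1 ((a.2 - (vertices d a.1 + 1)) / vertices d a.1)
      ((a.2 - (vertices d a.1 + 1)) % vertices d a.1) then 2 else 1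

theorem polyFun_reductionOut (d : ℕ) : PolyFun (reductionOut d) := by
  have hn := polyFun_vertices (α := (List Bool × ℕ) × ℕ) d
  have hp := PolyFun.snd (α := List Bool × ℕ)
  have hu := (hp.sub (hn.add (.const 1))).div hn
  have hv := (hp.sub (hn.add (.const 1))).mod hn
  classical
  exact .ite (.lt hp hn) (.const 2) (.ite (.eq hp hn) (.const 1) (.ite
    (.and (.ne hu hv) (.or (polyPred_hittingRel d hu hv) (polyPred_hittingRel d hv hu)))
    (.const 2) (.const 1)))

theorem length_encodeGraph {n : ℕ} (G : SimpleGraph (Fin n)) :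
    (encodeGraph G).length = n + 1 + n * n := by
  rw [encodeGraph, List.length_append, length_unary, matrixBits, List.length_ofFn]

theorem tape_of_getElem? {x : List Bool} {i : ℕ} {b : Bool} (h : x[i]? = some b) :
    tape x i = if b then 2 else 1 := by
  unfold tape
  rw [h]
  cases b <;> rfl

theorem tape_encodeGraph {d : ℕ} {I : List Bool × ℕ} {p : ℕ}
    (hp : p < vertices d I + 1 + vertices d I * vertices d I) :
    tape (encodeGraph (reductionGraph d I)) p = reductionOut d (I, p) := by
  classical
  set n := vertices d I with hn
  simp only [reductionOut, ← hn]
  rcases Nat.lt_or_ge n p with h | h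
  · rw [if_neg (by omega), if_neg (by omega)]
    have hg : p - (n + 1) < n * n := by omega
    have hpos : 0 < n := Nat.pos_of_ne_zero (by rintro h; simp [h] at hg)
    let u : Fin n := ⟨(p - (n + 1)) / n, Nat.div_lt_of_lt_mul hg⟩
    let v : Fin n := ⟨(p - (n + 1)) % n, Nat.mod_lt _ hpos⟩
    have hidx : p = n + 1 + (u.1 * n + v.1) := by
      simp only [u, v]
      have := Nat.div_add_mod' (p - (n + 1)) n
      omega
    have key : (encodeGraph (reductionGraph d I))[p]? =
        some (decide ((reductionGraph d I).Adj u v)) := by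
      rw [hidx, encodeGraph, getElem?_append_add _ (length_unary _), getElem?_matrixBits]
    rw [tape_of_getElem? key]
    simp only [decide_eq_true_eq, reductionGraph_adj, u, v]
  · rw [encodeGraph, tape_of_getElem? (getElem?_unary_append n _ h)]
    rcases h.lt_or_eq with h | h <;> simp [h]

end Reduction

/-- The reduction from weighted satisfiability of circuits of weft two and depth `d` to dominating
sets in claw-free graphs. -/
noncomputable def reduction {t : ℕ} (ht : 4 ≤ t) (d : ℕ) (I : WCSInst 2 d) :
    ClawFreeGraphInst t where
  n := vertices d (I.circuit.encode, I.k)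
  graph := reductionGraph d (I.circuit.encode, I.k)
  k := colours d (I.circuit.encode, I.k)
  clawFree := hittingGraph_clawFree ht

/-- The chain runs from the circuit through local constraints and hitting sets to the graph. The
alphabet is never empty, even on strings that encode no circuit, thanks to the summand `2`. -/
theorem weightedSat_iff_reduction {t : ℕ} (ht : 4 ≤ t) (d : ℕ) (I : WCSInst 2 d) :
    (WCS 2 d).Yes I ↔ (dominatingSetClawFree t).Yes (reduction ht d I) := by
  obtain ⟨C, k, hweft, hdepth⟩ := I
  have hA : 0 < (rawTable C.encode).alphabet d := by
    unfold GateTable.alphabet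
    omega
  refine (Circuit.local_iff_weightedSat hweft hdepth k).symm.trans ?_
  rw [← C.rawTable_encode, ← C.rawOut_encode]
  exact ((localMem_hitting_iff (by omega) hA (Nat.succ_pos _)).symm.trans
    (hittingGraph_dominatingSet_iff (pow_pos hA _)).symm)

theorem fptReducible_dominatingSetClawFree {t : ℕ} (ht : 4 ≤ t) {d : ℕ} {P : ParamProblem}
    (h : FPTReducible P (WCS 2 d)) : FPTReducible P (dominatingSetClawFree t) := by
  have hn := polyFun_vertices (α := List Bool × ℕ) d
  refine h.trans_polyFun (reduction ht d) ((hn.add (.const 1)).add (hn.mul hn))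
    (polyFun_colours (α := List Bool × ℕ) d) (polyFun_reductionOut d)
    (fun I => length_encodeGraph _) (fun I i hi => tape_encodeGraph hi) (fun I => rfl)
    -- The new parameter is the number of colours, which depends only on `k` because `d` is fixed.
    -- The factor `1` merely matches `computable_mul_pow`.
    (g := fun k => 1 * (k + 3) ^ (2 ^ (d + 1) + 3))
    (computable_mul_pow (computable_add Computable.id (Computable.const 3)) _ _)
    (fun a b hab => ?_) (fun I => ?_) (weightedSat_iff_reduction ht d)
  · dsimp only
    gcongr
  · exact (one_mul _).ge

end ParamComplexity

theorem theorem2 (t : ℕ) (ht : 4 ≤ t) :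
    ParamComplexity.WHard 2 (ParamComplexity.dominatingSetClawFree t) := by
  rintro P ⟨d, hd⟩
  exact ParamComplexity.fptReducible_dominatingSetClawFree ht hd
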